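/- Let $(\mathscr C,\mathbb T)$, $\mathbb T=(T,p,0,+,\ell,c)$, be a tangent category (in the sense of Cockett and Cruttwell), and write $\mathrm{Ind}(\mathscr C)$ for the category whose objects are functors $\underline X=(X_i)_{i\in I}$ from small filtered categories $I$ to $\mathscr C$, with $\mathrm{Ind}(\mathscr C)(\underline X,\underline Y)=\varprojlim_{i}\varinjlim_{j}\mathscr C(X_i,Y_j)$. Let $\mathrm{Ind}(\mathbb T)$ be the structure on $\mathrm{Ind}(\mathscr C)$ obtained by applying $T,p,0,+,\ell,c$ levelwise, so that for instance $\mathrm{Ind}(T)(X_i)=(TX_i)$. Recall that a differential bundle in a tangent category is a morphism $q:E\to M$ with $\sigma:E\times_M E\to E$, $\zeta:M\to E$ and $\lambda:E\to TE$ such that: $(q,\sigma,\zeta)$ is a commutative monoid over $M$; all finite pullback powers of $q$ exist and are preserved by all $T^m$; $(\lambda,0_M):(q,\sigma,\zeta)\to(Tq,T\sigma,T\zeta)$ and $(\lambda,\zeta):(q,\sigma,\zeta)\to(p_E,+_E,0_E)$ are morphisms of additive bundles; with $\mu=T\sigma\circ\langle\lambda\pi_0,0_E\pi_1\rangle:E\times_M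 E\to TE$, the square $Tq\circ\mu=0_M\circ q\pi_1$ is a pullback that is preserved by all $T^n$; and $\ell_E\circ\lambda=T\lambda\circ\lambda$. A linear morphism of differential bundles $(q,\sigma,\zeta,\lambda)\to(q',\sigma',\zeta',\lambda')$ is a pair $(f,g)$ with $q'f=gq$ and $\lambda' f=Tf\circ\lambda$. Let $I$ be a small filtered category and let $\underline E=(E_i)_{i\in I}$, $\underline M=(M_i)_{i\in I}$ be ind-objects of $\mathscr C$ indexed by $I$. Suppose that for each object $i$ of $I$ there is given a differential bundle $(q_i:E_i\to M_i,\ \sigma_i,\ \zeta_i,\ \lambda_i)$ in $\mathscr C$, and that for each morphism $\varphi:i\to i'$ of $I$ the pair of transition maps $(\underline E(\varphi),\underline M(\varphi))$ is a linear morphism of differential bundles from $(q_i,\sigma_i,\zeta_i,\lambda_i)$ to $(q_{i'},\sigma_{i'},\zeta_{i'},\lambda_{i'})$. Then $(\mathrm{Ind}(\mathscr C),\mathrm{Ind}(\mathbb T))$ is a tangent category; the families $(q_i)$, $(\sigma_i)$, $(\zeta_i)$, $(\lambda_i)$ are natural in $i$, with respect to the induced transition maps on $(E_i\times_{M_i}E_i)_{i\in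 I}$, and so define morphisms $\underline q:\underline E\to\underline M$, $\underline\sigma:(E_i\times_{M_i}E_i)_{i\in I}\to\underline E$, $\underline\zeta:\underline M\to\underline E$, $\underline\lambda:\underline E\to\mathrm{Ind}(T)\underline E$ in $\mathrm{Ind}(\mathscr C)$; and $(\underline q,\underline\sigma,\underline\zeta,\underline\lambda)$ is a differential bundle in $(\mathrm{Ind}(\mathscr C),\mathrm{Ind}(\mathbb T))$, where $(E_i\times_{M_i}E_i)_{i\in I}$ with the levelwise projections is the pullback $\underline E\times_{\underline M}\underline E$. -/

import Mathlib

open CategoryTheory CategoryTheory.Limits Opposite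

universe w w' v u v' u' v'' u''

/-! ## Additive bundles -/

/-- The data of an additive bundle `q : E ⟶ M`: an object `E₂` with two projections to `E`
(required below to be the pullback `E ×_M E`), an addition `σ : E₂ ⟶ E` and a zero section. -/
structure AddBundle {C : Type u} [Category.{v} C] (E M : C) where
  q : E ⟶ M
  E₂ : C
  π₀ : E₂ ⟶ E
  π₁ : E₂ ⟶ E
  σ : E₂ ⟶ E
  ζ : M ⟶ E

namespace AddBundle

/-- `E₂` is the pullback `E ×_M E` and `(q, σ, ζ)` is a commutative monoid in the slice category
over `M`. The associativity law, an equality of two maps out of the triple fibre product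
`E ×_M E ×_M E`, is stated on generalized elements `a, b, c : Z ⟶ E` of it. -/
structure IsAdditive {C : Type u} [Category.{v} C] {E M : C} (B : AddBundle E M) : Prop where
  isPullback : IsPullback B.π₀ B.π₁ B.q B.q
  σ_q : B.σ ≫ B.q = B.π₀ ≫ B.q
  ζ_q : B.ζ ≫ B.q = 𝟙 M
  left_unit : isPullback.lift (B.q ≫ B.ζ) (𝟙 E) (by simp [ζ_q]) ≫ B.σ = 𝟙 E
  right_unit : isPullback.lift (𝟙 E) (B.q ≫ B.ζ) (by simp [ζ_q]) ≫ B.σ = 𝟙 E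
  comm : isPullback.lift B.π₁ B.π₀ isPullback.w.symm ≫ B.σ = B.σ
  assoc : ∀ {Z : C} (a b c : Z ⟶ E) (hab : a ≫ B.q = b ≫ B.q) (hbc : b ≫ B.q = c ≫ B.q),
    isPullback.lift (isPullback.lift a b hab ≫ B.σ) c (by simp [σ_q, hab, hbc]) ≫ B.σ =
      isPullback.lift a (isPullback.lift b c hbc ≫ B.σ) (by simp [σ_q, hab]) ≫ B.σ

/-- The image of the data of an additive bundle under a functor. -/
@[simps]
def map {C : Type u} [Category.{v} C] {D : Type u'} [Category.{v'} D] {E M : C}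
    (B : AddBundle E M) (F : C ⥤ D) : AddBundle (F.obj E) (F.obj M) where
  q := F.map B.q
  E₂ := F.obj B.E₂
  π₀ := F.map B.π₀
  π₁ := F.map B.π₁
  σ := F.map B.σ
  ζ := F.map B.ζ

/-- `(f, g)` is a morphism of additive bundles. In `add`, the map `k` is the induced map
`⟨f ∘ π₀, f ∘ π₁⟩ : E ×_M E ⟶ F ×_N F`; it is the only map with the first two properties
as soon as `B'.E₂` is the pullback `F ×_N F`. -/
structure IsMorphism {C : Type u} [Category.{v} C] {E M F N : C}
    (B : AddBundle E M) (B' : AddBundle F N) (f : E ⟶ F) (g : M ⟶ N) : Prop where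
  w : f ≫ B'.q = B.q ≫ g
  add : ∃ k : B.E₂ ⟶ B'.E₂, k ≫ B'.π₀ = B.π₀ ≫ f ∧ k ≫ B'.π₁ = B.π₁ ≫ f ∧
    k ≫ B'.σ = B.σ ≫ f
  zero : g ≫ B'.ζ = B.ζ ≫ f

end AddBundle

/-- The `m`-fold composite `T ⋙ ⋯ ⋙ T` of an endofunctor. -/
def iterFunctor {C : Type u} [Category.{v} C] (T : C ⥤ C) : ℕ → (C ⥤ C)
  | 0 => 𝟭 C
  | m + 1 => iterFunctor T m ⋙ T

/-- All finite pullback powers `E ×_M ⋯ ×_M E` of `q : E ⟶ M` exist and are preserved by all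
iterates of `T`. -/
def HasPreservedPullbackPowers {C : Type u} [Category.{v} C] (T : C ⥤ C) {E M : C}
    (q : E ⟶ M) : Prop :=
  ∀ n : ℕ, HasWidePullback M (fun _ : Fin n => E) (fun _ => q) ∧
    ∀ m : ℕ, PreservesLimit (WidePullbackShape.wideCospan M (fun _ : Fin n => E) (fun _ => q))
      (iterFunctor T m)

/-! ## Tangent categories -/

/-- The data `(T, p, 0, +, ℓ, c)` of a tangent structure. The functor `T₂` with its two projections
to `T` is required in `TangentData.IsTangent` to be a pullback of `p` along itself. -/
structure TangentData (C : Type u) [Category.{v} C] where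
  T : C ⥤ C
  p : T ⟶ 𝟭 C
  zero : 𝟭 C ⟶ T
  T₂ : C ⥤ C
  π₀ : T₂ ⟶ T
  π₁ : T₂ ⟶ T
  add : T₂ ⟶ T
  ℓ : T ⟶ T ⋙ T
  c : T ⋙ T ⟶ T ⋙ T

namespace TangentData

/-- The tangent bundle `(p_X, +_X, 0_X)` of an object `X`. -/
@[simps]
def tangentBundle {C : Type u} [Category.{v} C] (𝕋 : TangentData C) (X : C) :
    AddBundle (𝕋.T.obj X) X where
  q := 𝕋.p.app X
  E₂ := 𝕋.T₂.obj X
  π₀ := 𝕋.π₀.app X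
  π₁ := 𝕋.π₁.app X
  σ := 𝕋.add.app X
  ζ := 𝕋.zero.app X

/-- The axioms of a tangent structure. -/
structure IsTangent {C : Type u} [Category.{v} C] (𝕋 : TangentData C) : Prop where
  powers : ∀ X : C, HasPreservedPullbackPowers 𝕋.T (𝕋.p.app X)
  additive : ∀ X : C, (𝕋.tangentBundle X).IsAdditive
  /-- `(ℓ, 0)` is a morphism of additive bundles from `(p, +, 0)` to `(T p, T +, T 0)`. -/
  lift_morphism : ∀ X : C, AddBundle.IsMorphism (𝕋.tangentBundle X)
    ((𝕋.tangentBundle X).map 𝕋.T) (𝕋.ℓ.app X) (𝕋.zero.app X)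
  /-- `(c, id)` is a morphism of additive bundles from `(T p, T +, T 0)` to
  `(p_T, +_T, 0_T)`. -/
  flip_morphism : ∀ X : C, AddBundle.IsMorphism ((𝕋.tangentBundle X).map 𝕋.T)
    (𝕋.tangentBundle (𝕋.T.obj X)) (𝕋.c.app X) (𝟙 (𝕋.T.obj X))
  flip_flip : ∀ X : C, 𝕋.c.app X ≫ 𝕋.c.app X = 𝟙 _
  lift_flip : ∀ X : C, 𝕋.ℓ.app X ≫ 𝕋.c.app X = 𝕋.ℓ.app X
  lift_lift : ∀ X : C, 𝕋.ℓ.app X ≫ 𝕋.T.map (𝕋.ℓ.app X) = 𝕋.ℓ.app X ≫ 𝕋.ℓ.app (𝕋.T.obj X)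
  yang_baxter : ∀ X : C,
    𝕋.T.map (𝕋.c.app X) ≫ 𝕋.c.app (𝕋.T.obj X) ≫ 𝕋.T.map (𝕋.c.app X) =
      𝕋.c.app (𝕋.T.obj X) ≫ 𝕋.T.map (𝕋.c.app X) ≫ 𝕋.c.app (𝕋.T.obj X)
  flip_lift : ∀ X : C,
    𝕋.ℓ.app (𝕋.T.obj X) ≫ 𝕋.T.map (𝕋.c.app X) ≫ 𝕋.c.app (𝕋.T.obj X) =
      𝕋.c.app X ≫ 𝕋.T.map (𝕋.ℓ.app X)
  /-- Universality of the vertical lift; `k` is `⟨ℓ ∘ π₀, 0_T ∘ π₁⟩ : T₂ X ⟶ T (T₂ X)`. -/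
  universal : ∀ X : C, ∃ k : 𝕋.T₂.obj X ⟶ 𝕋.T.obj (𝕋.T₂.obj X),
    k ≫ 𝕋.T.map (𝕋.π₀.app X) = 𝕋.π₀.app X ≫ 𝕋.ℓ.app X ∧
    k ≫ 𝕋.T.map (𝕋.π₁.app X) = 𝕋.π₁.app X ≫ 𝕋.zero.app (𝕋.T.obj X) ∧
    ∃ h : (k ≫ 𝕋.T.map (𝕋.add.app X)) ≫ 𝕋.T.map (𝕋.p.app X) =
        (k ≫ 𝕋.T.map (𝕋.add.app X)) ≫ 𝕋.p.app (𝕋.T.obj X) ≫ 𝕋.p.app X ≫ 𝕋.zero.app X,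
      Nonempty (IsLimit (Fork.ofι (k ≫ 𝕋.T.map (𝕋.add.app X)) h))

end TangentData

/-! ## Differential bundles -/

/-- The data `(q, σ, ζ, λ)` of a differential bundle `q : E ⟶ M`. -/
structure DiffBundle {C : Type u} [Category.{v} C] (𝕋 : TangentData C) (E M : C)
    extends AddBundle E M where
  lam : E ⟶ 𝕋.T.obj E

namespace DiffBundle

/-- The axioms of a differential bundle. -/
structure IsDifferential {C : Type u} [Category.{v} C] {𝕋 : TangentData C} {E M : C}
    (B : DiffBundle 𝕋 E M) : Prop where
  additive : B.toAddBundle.IsAdditive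
  powers : HasPreservedPullbackPowers 𝕋.T B.q
  /-- `(λ, 0)` is a morphism of additive bundles from `(q, σ, ζ)` to `(T q, T σ, T ζ)`. -/
  lift_zero : AddBundle.IsMorphism B.toAddBundle (B.toAddBundle.map 𝕋.T) B.lam (𝕋.zero.app M)
  /-- `(λ, ζ)` is a morphism of additive bundles from `(q, σ, ζ)` to `(p, +, 0)`. -/
  lift_zeta : AddBundle.IsMorphism B.toAddBundle (𝕋.tangentBundle E) B.lam B.ζ
  /-- Universality of the lift: with `k = ⟨λ ∘ π₀, 0 ∘ π₁⟩ : E₂ ⟶ T E₂` and `μ = T σ ∘ k`, the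
  square with sides `μ`, `q ∘ π₁`, `T q`, `0` is a pullback, preserved by all iterates of `T`. -/
  universal : ∃ k : B.E₂ ⟶ 𝕋.T.obj B.E₂,
    k ≫ 𝕋.T.map B.π₀ = B.π₀ ≫ B.lam ∧
    k ≫ 𝕋.T.map B.π₁ = B.π₁ ≫ 𝕋.zero.app E ∧
    IsPullback (k ≫ 𝕋.T.map B.σ) (B.π₁ ≫ B.q) (𝕋.T.map B.q) (𝕋.zero.app M) ∧
    ∀ n : ℕ, IsPullback ((iterFunctor 𝕋.T n).map (k ≫ 𝕋.T.map B.σ))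
      ((iterFunctor 𝕋.T n).map (B.π₁ ≫ B.q)) ((iterFunctor 𝕋.T n).map (𝕋.T.map B.q))
      ((iterFunctor 𝕋.T n).map (𝕋.zero.app M))
  lift_lift : B.lam ≫ 𝕋.ℓ.app E = B.lam ≫ 𝕋.T.map B.lam

/-- `(f, g)` is a linear morphism of differential bundles. -/
structure IsLinearMorphism {C : Type u} [Category.{v} C] {𝕋 : TangentData C} {E M F N : C}
    (B : DiffBundle 𝕋 E M) (B' : DiffBundle 𝕋 F N) (f : E ⟶ F) (g : M ⟶ N) : Prop where
  w : f ≫ B'.q = B.q ≫ g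
  lift : f ≫ B'.lam = B.lam ≫ 𝕋.T.map f

end DiffBundle

/-! ## The category of ind-objects, with `Hom(X, Y) = lim_i colim_j Hom(X_i, Y_j)` -/

/-- An ind-object of `C`: a functor to `C` from a small filtered category. -/
structure IndObj (C : Type u) [Category.{v} C] where
  I : Type w
  [cat : SmallCategory I]
  [filtered : IsFiltered I]
  diag : I ⥤ C

namespace IndObj

attribute [instance] IndObj.cat IndObj.filtered

/-- The ind-object `(F_i)` given by a functor `F`. -/
abbrev of {C : Type u} [Category.{v} C] {I : Type w} [SmallCategory I] [IsFiltered I]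
    (F : I ⥤ C) : IndObj.{w} C :=
  IndObj.mk I F

/-- The set `colim_j Hom(A, Y_j)`. -/
abbrev ColimHom {C : Type u} [Category.{v} C] (A : C) (Y : IndObj.{w} C) : Type (max w v) :=
  (Y.diag ⋙ coyoneda.obj (op A)).ColimitType

namespace ColimHom

/-- The class of `f : A ⟶ Y_j` in `colim_j Hom(A, Y_j)`. -/
def mk {C : Type u} [Category.{v} C] {A : C} {Y : IndObj.{w} C} (j : Y.I) (f : A ⟶ Y.diag.obj j) :
    ColimHom A Y :=
  (Y.diag ⋙ coyoneda.obj (op A)).ιColimitType j f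

theorem mk_map {C : Type u} [Category.{v} C] {A : C} {Y : IndObj.{w} C} {j j' : Y.I}
    (f : A ⟶ Y.diag.obj j) (φ : j ⟶ j') : mk j' (f ≫ Y.diag.map φ) = mk j f :=
  (Y.diag ⋙ coyoneda.obj (op A)).ιColimitType_map φ f

theorem ind {C : Type u} [Category.{v} C] {A : C} {Y : IndObj.{w} C} {P : ColimHom A Y → Prop}
    (h : ∀ (j : Y.I) (f : A ⟶ Y.diag.obj j), P (mk j f)) (x : ColimHom A Y) : P x := by
  obtain ⟨j, f⟩ := x
  exact h j f

/-- Maps out of `colim_j Hom(A, Y_j)`. -/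
def lift {C : Type u} [Category.{v} C] {A : C} {Y : IndObj.{w} C} {S : Type w'}
    (F : ∀ j : Y.I, (A ⟶ Y.diag.obj j) → S)
    (hF : ∀ {j j' : Y.I} (φ : j ⟶ j') (f : A ⟶ Y.diag.obj j), F j' (f ≫ Y.diag.map φ) = F j f) :
    ColimHom A Y → S :=
  Quot.lift (fun x => F x.1 x.2) (by
    rintro ⟨j, f⟩ ⟨j', f'⟩ ⟨φ, h⟩
    have h' : f' = f ≫ Y.diag.map φ := h
    change F j f = F j' f'
    rw [h']
    exact (hF φ f).symm)

@[simp]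
theorem lift_mk {C : Type u} [Category.{v} C] {A : C} {Y : IndObj.{w} C} {S : Type w'}
    (F : ∀ j : Y.I, (A ⟶ Y.diag.obj j) → S)
    (hF : ∀ {j j' : Y.I} (φ : j ⟶ j') (f : A ⟶ Y.diag.obj j), F j' (f ≫ Y.diag.map φ) = F j f)
    (j : Y.I) (f : A ⟶ Y.diag.obj j) : lift F hF (mk j f) = F j f := rfl

/-- Precomposition with `a : A' ⟶ A`. -/
def precomp {C : Type u} [Category.{v} C] {A A' : C} {Y : IndObj.{w} C} (a : A' ⟶ A) :
    ColimHom A Y → ColimHom A' Y :=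
  lift (fun j f => mk j (a ≫ f)) (fun φ f => by rw [← Category.assoc, mk_map])

@[simp]
theorem precomp_mk {C : Type u} [Category.{v} C] {A A' : C} {Y : IndObj.{w} C} (a : A' ⟶ A)
    (j : Y.I) (f : A ⟶ Y.diag.obj j) : precomp a (mk j f) = mk j (a ≫ f) := rfl

end ColimHom

/-- A morphism of ind-objects is an element of `lim_i colim_j Hom(X_i, Y_j)`. -/
@[ext]
structure Hom {C : Type u} [Category.{v} C] (X Y : IndObj.{w} C) where
  app (i : X.I) : ColimHom (X.diag.obj i) Y
  compat {i i' : X.I} (φ : i ⟶ i') : ColimHom.precomp (X.diag.map φ) (app i') = app i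

/-- Postcomposition `colim_j Hom(A, Y_j) → colim_k Hom(A, Z_k)` with a morphism of ind-objects,
sending the class of `f : A ⟶ Y_j` to the class of `g ∘ f` if `g : Y_j ⟶ Z_k` represents the
`j`-th component. -/
def ColimHom.postcomp {C : Type u} [Category.{v} C] {A : C} {Y Z : IndObj.{w} C} (g : Hom Y Z) :
    ColimHom A Y → ColimHom A Z :=
  ColimHom.lift (fun j f => ColimHom.precomp f (g.app j)) (fun {j j'} φ f => by
    rw [← g.compat φ]
    induction g.app j' using ColimHom.ind with
    | h k h => simp)

@[simp]
theorem ColimHom.postcomp_mk {C : Type u} [Category.{v} C] {A : C} {Y Z : IndObj.{w} C}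
    (g : Hom Y Z) (j : Y.I) (f : A ⟶ Y.diag.obj j) :
    ColimHom.postcomp g (ColimHom.mk j f) = ColimHom.precomp f (g.app j) := rfl

theorem ColimHom.postcomp_precomp {C : Type u} [Category.{v} C] {A A' : C} {Y Z : IndObj.{w} C}
    (g : Hom Y Z) (a : A' ⟶ A) (x : ColimHom A Y) :
    ColimHom.postcomp g (ColimHom.precomp a x) = ColimHom.precomp a (ColimHom.postcomp g x) := by
  induction x using ColimHom.ind with
  | h j f =>
    simp only [ColimHom.precomp_mk, ColimHom.postcomp_mk]
    induction g.app j using ColimHom.ind with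
    | h k h => simp

/-- Composition of morphisms of ind-objects. -/
def Hom.comp {C : Type u} [Category.{v} C] {X Y Z : IndObj.{w} C} (f : Hom X Y) (g : Hom Y Z) :
    Hom X Z where
  app i := ColimHom.postcomp g (f.app i)
  compat φ := by rw [← ColimHom.postcomp_precomp, f.compat]

/-- A natural transformation between two diagrams on the same index category, as a morphism of
ind-objects. -/
def levelHom {C : Type u} [Category.{v} C] {I : Type w} [SmallCategory I] [IsFiltered I]
    {F G : I ⥤ C} (α : F ⟶ G) : Hom (IndObj.of F) (IndObj.of G) where
  app i := ColimHom.mk (Y := IndObj.of G) i (α.app i)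
  compat φ := by
    simp only [ColimHom.precomp_mk, NatTrans.naturality]
    exact ColimHom.mk_map (Y := IndObj.of G) _ φ

instance {C : Type u} [Category.{v} C] : Category.{max w v} (IndObj.{w} C) where
  Hom X Y := Hom X Y
  id X := levelHom (𝟙 X.diag)
  comp f g := Hom.comp f g
  id_comp f := by
    apply Hom.ext
    funext i
    change ColimHom.precomp (𝟙 _) (f.app i) = f.app i
    induction f.app i using ColimHom.ind with
    | h k h => simp
  comp_id f := by
    apply Hom.ext
    funext i
    change ColimHom.postcomp (levelHom (𝟙 _)) (f.app i) = f.app i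
    induction f.app i using ColimHom.ind with
    | h k h =>
      change ColimHom.mk k (h ≫ 𝟙 _) = _
      simp
  assoc {W X Y Z} f g h := by
    apply Hom.ext
    funext i
    change ColimHom.postcomp h (ColimHom.postcomp g (f.app i)) =
      ColimHom.postcomp (Hom.comp g h) (f.app i)
    induction f.app i using ColimHom.ind with
    | h k a =>
      simp only [ColimHom.postcomp_mk, ColimHom.postcomp_precomp]
      rfl

/-- `levelHom` as a morphism of the category of ind-objects. -/
def level {C : Type u} [Category.{v} C] {I : Type w} [SmallCategory I] [IsFiltered I]
    {F G : I ⥤ C} (α : F ⟶ G) : (IndObj.of F : IndObj.{w} C) ⟶ IndObj.of G :=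
  levelHom α

theorem hom_ext {C : Type u} [Category.{v} C] {X Y : IndObj.{w} C} {f g : X ⟶ Y}
    (h : ∀ i, Hom.app f i = Hom.app g i) : f = g :=
  Hom.ext (funext h)

theorem comp_app {C : Type u} [Category.{v} C] {X Y Z : IndObj.{w} C} (f : X ⟶ Y) (g : Y ⟶ Z)
    (i : X.I) : Hom.app (f ≫ g) i = ColimHom.postcomp g (Hom.app f i) := rfl

theorem level_comp {C : Type u} [Category.{v} C] {I : Type w} [SmallCategory I] [IsFiltered I]
    {F G H : I ⥤ C} (α : F ⟶ G) (β : G ⟶ H) : level (α ≫ β) = level α ≫ level β := rfl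

theorem level_id {C : Type u} [Category.{v} C] {I : Type w} [SmallCategory I] [IsFiltered I]
    (F : I ⥤ C) : level (𝟙 F) = 𝟙 (IndObj.of F) := rfl

/-! ### Ind of functors and natural transformations -/

/-- The map `colim_j Hom(A, Y_j) → colim_j Hom(F A, F Y_j)`. -/
def ColimHom.map {C : Type u} [Category.{v} C] {D : Type u'} [Category.{v'} D] (F : C ⥤ D) {A : C}
    {Y : IndObj.{w} C} : ColimHom A Y → ColimHom (F.obj A) (IndObj.of (Y.diag ⋙ F)) :=
  ColimHom.lift (fun j f => ColimHom.mk (Y := IndObj.of (Y.diag ⋙ F)) j (F.map f)) (fun φ f => by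
    rw [F.map_comp]
    exact ColimHom.mk_map (Y := IndObj.of (Y.diag ⋙ F)) (F.map f) φ)

@[simp]
theorem ColimHom.map_mk {C : Type u} [Category.{v} C] {D : Type u'} [Category.{v'} D] (F : C ⥤ D)
    {A : C} {Y : IndObj.{w} C} (j : Y.I) (f : A ⟶ Y.diag.obj j) :
    ColimHom.map F (ColimHom.mk j f) =
      ColimHom.mk (Y := IndObj.of (Y.diag ⋙ F)) j (F.map f) := rfl

theorem ColimHom.map_precomp {C : Type u} [Category.{v} C] {D : Type u'} [Category.{v'} D]
    (F : C ⥤ D) {A A' : C} {Y : IndObj.{w} C} (a : A' ⟶ A) (x : ColimHom A Y) :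
    ColimHom.map F (ColimHom.precomp a x) = ColimHom.precomp (F.map a) (ColimHom.map F x) := by
  induction x using ColimHom.ind with
  | h j f =>
    simp only [ColimHom.precomp_mk, ColimHom.map_mk, F.map_comp]

/-- The functor `Ind(F)`, sending `(X_i)` to `(F X_i)`. -/
def indFunctor {C : Type u} [Category.{v} C] {D : Type u'} [Category.{v'} D] (F : C ⥤ D) :
    IndObj.{w} C ⥤ IndObj.{w} D where
  obj X := IndObj.of (X.diag ⋙ F)
  map {X Y} f :=
    { app := fun i => ColimHom.map F (Hom.app f i)
      compat := fun φ => by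
        rw [← Hom.compat f φ, ColimHom.map_precomp]
        rfl }
  map_id X := by
    apply hom_ext
    intro i
    change ColimHom.mk (Y := IndObj.of (X.diag ⋙ F)) i (F.map (𝟙 _)) =
      ColimHom.mk (Y := IndObj.of (X.diag ⋙ F)) i (𝟙 _)
    rw [F.map_id]
    rfl
  map_comp {X Y Z} f g := by
    apply hom_ext
    intro i
    change ColimHom.map F (ColimHom.postcomp g (Hom.app f i)) =
      ColimHom.postcomp _ (ColimHom.map F (Hom.app f i))
    induction Hom.app f i using ColimHom.ind with
    | h j a =>
      rw [ColimHom.postcomp_mk, ColimHom.map_precomp]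
      rfl

/-- The natural transformation `Ind(α)`, with components `(α_{X_i})`. -/
def indNat {C : Type u} [Category.{v} C] {D : Type u'} [Category.{v'} D] {F G : C ⥤ D}
    (α : F ⟶ G) : indFunctor.{w} F ⟶ indFunctor.{w} G where
  app X := level (Functor.whiskerLeft X.diag α)
  naturality X Y f := by
    apply hom_ext
    intro i
    change ColimHom.postcomp (level (Functor.whiskerLeft Y.diag α))
      (ColimHom.map F (Hom.app f i)) =
        ColimHom.precomp (α.app (X.diag.obj i)) (ColimHom.map G (Hom.app f i))
    induction Hom.app f i using ColimHom.ind with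
    | h j a =>
      change ColimHom.mk (Y := IndObj.of (Y.diag ⋙ G)) j (F.map a ≫ α.app _) =
        ColimHom.mk (Y := IndObj.of (Y.diag ⋙ G)) j (α.app _ ≫ G.map a)
      rw [α.naturality]

/-- The identification of `Ind(id)` with the identity functor. -/
def indId (C : Type u) [Category.{v} C] : indFunctor.{w} (𝟭 C) ≅ 𝟭 (IndObj.{w} C) :=
  NatIso.ofComponents (fun X => Iso.refl X) (fun {X Y} f => by
    apply hom_ext
    intro i
    change ColimHom.postcomp (𝟙 Y) (ColimHom.map (𝟭 C) (Hom.app f i)) =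
      ColimHom.precomp (𝟙 _) (Hom.app f i)
    induction Hom.app f i using ColimHom.ind with
    | h j a =>
      change ColimHom.mk j (a ≫ 𝟙 _) = ColimHom.mk j (𝟙 _ ≫ a)
      rw [Category.comp_id, Category.id_comp])

/-- The compositor isomorphism `Ind(G ∘ F) ≅ Ind(G) ∘ Ind(F)`. -/
def indComp {C : Type u} [Category.{v} C] {D : Type u'} [Category.{v'} D] {E : Type u''}
    [Category.{v''} E] (F : C ⥤ D) (G : D ⥤ E) :
    indFunctor.{w} (F ⋙ G) ≅ indFunctor.{w} F ⋙ indFunctor.{w} G :=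
  NatIso.ofComponents (fun X => Iso.refl (IndObj.of (X.diag ⋙ F ⋙ G))) (fun {X Y} f => by
    apply hom_ext
    intro i
    change ColimHom.postcomp (𝟙 (IndObj.of (Y.diag ⋙ F ⋙ G)))
        (ColimHom.map (F ⋙ G) (Hom.app f i)) =
      ColimHom.precomp (𝟙 _) (ColimHom.map G (ColimHom.map F (Hom.app f i)))
    induction Hom.app f i using ColimHom.ind with
    | h j a =>
      change ColimHom.mk (Y := IndObj.of (Y.diag ⋙ F ⋙ G)) j (G.map (F.map a) ≫ 𝟙 _) =
        ColimHom.mk (Y := IndObj.of (Y.diag ⋙ F ⋙ G)) j (𝟙 _ ≫ G.map (F.map a))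
      rw [Category.comp_id, Category.id_comp])

end IndObj

/-! ## The tangent structure on ind-objects and levelwise bundles -/

/-- The data `(Ind(T), Ind(p), Ind(0), Ind(+), Ind(ℓ), Ind(c))` on the category of ind-objects, the
role of `T₂` being played by `Ind(T₂)`. -/
def TangentData.ind {C : Type u} [Category.{v} C] (𝕋 : TangentData C) :
    TangentData (IndObj.{w} C) where
  T := IndObj.indFunctor 𝕋.T
  p := IndObj.indNat 𝕋.p ≫ (IndObj.indId C).hom
  zero := (IndObj.indId C).inv ≫ IndObj.indNat 𝕋.zero
  T₂ := IndObj.indFunctor 𝕋.T₂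
  π₀ := IndObj.indNat 𝕋.π₀
  π₁ := IndObj.indNat 𝕋.π₁
  add := IndObj.indNat 𝕋.add
  ℓ := IndObj.indNat 𝕋.ℓ ≫ (IndObj.indComp 𝕋.T 𝕋.T).hom
  c := (IndObj.indComp 𝕋.T 𝕋.T).inv ≫ IndObj.indNat 𝕋.c ≫ (IndObj.indComp 𝕋.T 𝕋.T).hom

/-- A diagram of differential bundles and linear morphisms, on an index category `I`. -/
structure DiffBundleDiagram {C : Type u} [Category.{v} C] (𝕋 : TangentData C)
    {I : Type w} [Category.{w'} I] (E M : I ⥤ C) where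
  bundle : ∀ i : I, DiffBundle 𝕋 (E.obj i) (M.obj i)
  isDifferential : ∀ i : I, (bundle i).IsDifferential
  isLinear : ∀ {i i' : I} (φ : i ⟶ i'),
    DiffBundle.IsLinearMorphism (bundle i) (bundle i') (E.map φ) (M.map φ)

namespace DiffBundleDiagram

/-- The diagram `(E_i ×_{M_i} E_i)`, with the induced transition maps. -/
@[simps obj]
noncomputable def E₂ {C : Type u} [Category.{v} C] {𝕋 : TangentData C} {I : Type w} [Category.{w'} I]
    {E M : I ⥤ C} (B : DiffBundleDiagram 𝕋 E M) : I ⥤ C where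
  obj i := (B.bundle i).E₂
  map {i i'} φ := (B.isDifferential i').additive.isPullback.lift
    ((B.bundle i).π₀ ≫ E.map φ) ((B.bundle i).π₁ ≫ E.map φ) (by
      rw [Category.assoc, Category.assoc, (B.isLinear φ).w, ← Category.assoc, ← Category.assoc,
        (B.isDifferential i).additive.isPullback.w])
  map_id i := by
    apply (B.isDifferential i).additive.isPullback.hom_ext <;> simp
  map_comp {i i' i''} φ ψ := by
    apply (B.isDifferential i'').additive.isPullback.hom_ext <;> simp

/-- The first projection `(E_i ×_{M_i} E_i) ⟶ (E_i)`. -/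
@[simps]
noncomputable def π₀ {C : Type u} [Category.{v} C] {𝕋 : TangentData C} {I : Type w} [Category.{w'} I]
    {E M : I ⥤ C} (B : DiffBundleDiagram 𝕋 E M) : B.E₂ ⟶ E where
  app i := (B.bundle i).π₀
  naturality _ i' _ := (B.isDifferential i').additive.isPullback.lift_fst _ _ _

/-- The second projection `(E_i ×_{M_i} E_i) ⟶ (E_i)`. -/
@[simps]
noncomputable def π₁ {C : Type u} [Category.{v} C] {𝕋 : TangentData C} {I : Type w} [Category.{w'} I]
    {E M : I ⥤ C} (B : DiffBundleDiagram 𝕋 E M) : B.E₂ ⟶ E where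
  app i := (B.bundle i).π₁
  naturality _ i' _ := (B.isDifferential i').additive.isPullback.lift_snd _ _ _

end DiffBundleDiagram

/-- The data of a bundle in the category of ind-objects induced by natural transformations between
diagrams on the same index category. -/
def TangentData.levelBundle {C : Type u} [Category.{v} C] (𝕋 : TangentData C)
    {I : Type w} [SmallCategory I] [IsFiltered I] {E M E₂ : I ⥤ C}
    (q : E ⟶ M) (π₀ π₁ σ : E₂ ⟶ E) (ζ : M ⟶ E) (lam : E ⟶ E ⋙ 𝕋.T) :
    DiffBundle 𝕋.ind.{w} (IndObj.of E) (IndObj.of M) where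
  q := IndObj.level q
  E₂ := IndObj.of E₂
  π₀ := IndObj.level π₀
  π₁ := IndObj.level π₁
  σ := IndObj.level σ
  ζ := IndObj.level ζ
  lam := IndObj.level lam

/-! ## Finite limits of ind-objects -/

namespace IndObj

/-! Each axiom of a tangent structure or a differential bundle is either an equation between
structure maps or an assertion about finite limits: existence, a given universal property, or
preservation by iterates of `T`. For levelwise data over one index category `I`, the equations hold
in `Ind(C)` because `level` is functorial and natural transformations are compared pointwise.

For the limits, `toPresheaf` embeds `Ind(C)` fully faithfully into presheaves, hence reflects
limits, and its value at `A` on a levelwise object is a filtered colimit of the sets `Hom(A, F_i)`.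
Filtered colimits of sets commute with finite limits, so finite limits of `I`-diagrams that exist
pointwise become limits of ind-objects (`preservesLimit_levelFunctor`). If a functor `G` preserves
the pointwise limits, then `Ind(G)` preserves the resulting one (`preservesLimit_indFunctor`). Since
`C` need not have limits, everything is stated for a single diagram.

What remains is naturality of the bundle structure. For `q` and `λ` it is the definition of
linearity. For `ζ` and `σ` it is the fact that linear morphisms are automatically additive: `ζ` is
determined by `p ∘ λ = ζ ∘ q`, and `σ` is controlled by `λ`, which is a monomorphism (`mono_lam`)
carrying `σ` to the addition of the tangent bundle. -/

/-- The functor `(I ⥤ C) ⥤ Ind(C)` sending a diagram to the ind-object that it defines. -/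
def levelFunctor (C : Type u) [Category.{v} C] (I : Type w) [SmallCategory I] [IsFiltered I] :
    (I ⥤ C) ⥤ IndObj.{w} C where
  obj F := IndObj.of F
  map α := level α
  map_id _ := rfl
  map_comp _ _ := rfl

/-- The presheaf `A ↦ colim_j Hom(A, Y_j)` of an ind-object, functorially. -/
def toPresheaf (C : Type u) [Category.{v} C] : IndObj.{w} C ⥤ (Cᵒᵖ ⥤ Type (max w v)) where
  obj Y :=
    { obj := fun A => ColimHom A.unop Y
      map := fun a => ↾(ColimHom.precomp a.unop)
      map_id := fun A => by
        ext x
        induction x using ColimHom.ind with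
        | h j f => simp
      map_comp := fun a b => by
        ext x
        induction x using ColimHom.ind with
        | h j f => simp }
  map g :=
    { app := fun _ => ↾(ColimHom.postcomp g)
      naturality := fun _ _ a => by
        ext x
        exact ColimHom.postcomp_precomp g a.unop x }
  map_id Y := by
    ext A x
    induction x using ColimHom.ind with
    | h j f =>
      change ColimHom.mk j (f ≫ 𝟙 _) = ColimHom.mk j f
      rw [Category.comp_id]
  map_comp {X Y Z} g h := by
    ext A x
    induction x using ColimHom.ind with
    | h j f => exact (ColimHom.postcomp_precomp h f (Hom.app g j)).symm

/-- Yoneda argument: the class of `f` is the restriction along `f` of the tautological class of `𝟙`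
at level `j`. A map of presheaves is thus determined by the images of tautological classes, which
gives both faithfulness and fullness. -/
theorem toPresheaf_app_mk {C : Type u} [Category.{v} C] {X Y : IndObj.{w} C}
    (α : (toPresheaf C).obj X ⟶ (toPresheaf C).obj Y) {A : C} (j : X.I)
    (f : A ⟶ X.diag.obj j) :
    α.app (op A) (ColimHom.mk j f) =
      ColimHom.precomp f (α.app (op (X.diag.obj j)) (ColimHom.mk j (𝟙 _))) := by
  have h := ConcreteCategory.congr_hom (α.naturality f.op) (ColimHom.mk j (𝟙 _))
  refine Eq.trans (congrArg (α.app (op A)) ?_) h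
  change _ = ColimHom.mk j (f ≫ 𝟙 _)
  rw [Category.comp_id]

instance (C : Type u) [Category.{v} C] : (toPresheaf.{w} C).Faithful where
  map_injective {X Y} f g h := by
    apply hom_ext
    intro i
    have h' := ConcreteCategory.congr_hom (congrArg (fun α => NatTrans.app α (op (X.diag.obj i))) h)
      (ColimHom.mk i (𝟙 _))
    have key : ∀ k : X ⟶ Y, ColimHom.postcomp k (ColimHom.mk i (𝟙 (X.diag.obj i))) =
        Hom.app k i := fun k => by
      rw [ColimHom.postcomp_mk]
      induction Hom.app k i using ColimHom.ind with
      | h j a => simp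
    rw [← key f, ← key g]
    exact h'

instance (C : Type u) [Category.{v} C] : (toPresheaf.{w} C).Full where
  map_surjective {X Y} α := by
    refine ⟨⟨fun i => α.app (op (X.diag.obj i)) (ColimHom.mk i (𝟙 _)), fun {i i'} φ => ?_⟩, ?_⟩
    -- Compatibility holds because the tautological class at `i` is also represented at level `i'`
    -- by the transition map of `φ`.
    · rw [← toPresheaf_app_mk, ← ColimHom.mk_map (𝟙 (X.diag.obj i)) φ, Category.id_comp]
    · ext A x
      induction x using ColimHom.ind with
      | h j f => exact (toPresheaf_app_mk α j f).symm

/-- The cocone exhibiting `colim_j Hom(A, Y_j)` as a colimit in the category of types. -/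
def colimHomCocone {C : Type u} [Category.{v} C] {I : Type w} [SmallCategory I] [IsFiltered I]
    (A : C) (F : I ⥤ C) : Cocone (F ⋙ coyoneda.obj (op A) ⋙ uliftFunctor.{w, v}) where
  pt := ColimHom A (IndObj.of F)
  ι :=
    { app := fun j => ↾fun x => ColimHom.mk (Y := IndObj.of F) j x.down
      naturality := fun j j' φ => by
        ext x
        exact ColimHom.mk_map (Y := IndObj.of F) x.down φ }

/-- `colim_j Hom(A, Y_j)` is a colimit in the category of types. -/
def isColimitColimHomCocone {C : Type u} [Category.{v} C] {I : Type w} [SmallCategory I]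
    [IsFiltered I] (A : C) (F : I ⥤ C) : IsColimit (colimHomCocone A F) where
  desc s := ↾(ColimHom.lift (Y := IndObj.of F)
    (fun j f => s.ι.app j (ULift.up (α := A ⟶ F.obj j) f))
    (fun {j _} φ f => ConcreteCategory.congr_hom (s.w φ) (ULift.up (α := A ⟶ F.obj j) f)))
  fac s j := rfl
  uniq s m hm := by
    ext x
    induction x using ColimHom.ind with
    | h j f => exact ConcreteCategory.congr_hom (hm j) (ULift.up (α := A ⟶ F.obj j) f)

/-- The value at `A` of the presheaf of `(F_j)` is the colimit of the `Hom(A, F_j)`. -/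
noncomputable def levelToPresheafEvalIso {C : Type u} [Category.{v} C] {I : Type w}
    [SmallCategory I] [IsFiltered I] (A : C) :
    (Functor.whiskeringRight I C _).obj (coyoneda.obj (op A) ⋙ uliftFunctor.{w, v}) ⋙ colim ≅
      levelFunctor C I ⋙ toPresheaf C ⋙ (evaluation _ _).obj (op A) :=
  NatIso.ofComponents
    (fun F => (colimit.isColimit _).coconePointUniqueUpToIso (isColimitColimHomCocone A F))
    (fun {F G} α => by
      refine colimit.hom_ext fun j => ?_
      have h (F : I ⥤ C) := (colimit.isColimit _).comp_coconePointUniqueUpToIso_hom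
        (isColimitColimHomCocone A F) j
      refine (ι_colimMap_assoc _ _ _).trans (Eq.trans ?_ (Category.assoc _ _ _))
      exact (congrArg (fun t => _ ≫ t) (h G)).trans (congrArg (fun t => t ≫
        (levelFunctor C I ⋙ toPresheaf C ⋙ (evaluation _ _).obj (op A)).map α) (h F)).symm)

/-- Limits in functor categories are pointwise once the pointwise limits exist. Only limits of the
diagrams obtained from `K` are required, as `C` is not assumed complete. -/
theorem preservesLimit_whiskeringRight {C : Type u} [Category.{v} C] {D : Type u'}
    [Category.{v'} D] {I : Type*} [Category* I] {J : Type*} [Category* J] (K : J ⥤ I ⥤ C)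
    (G : C ⥤ D) [∀ i, HasLimit (K ⋙ (evaluation I C).obj i)]
    [∀ i, PreservesLimit (K ⋙ (evaluation I C).obj i) G] :
    PreservesLimit K ((Functor.whiskeringRight I C D).obj G) := by
  refine preservesLimit_of_evaluation _ _ fun i => ?_
  have : ∀ i, HasLimit (K.flip.obj i) := fun i =>
    inferInstanceAs (HasLimit (K ⋙ (evaluation I C).obj i))
  change PreservesLimit K ((evaluation I C).obj i ⋙ G)
  infer_instance

/-- Finite limits of diagrams on `I` that are computed pointwise are limits of ind-objects. -/
theorem preservesLimit_levelFunctor {C : Type u} [Category.{v} C] {I : Type w}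
    [SmallCategory I] [IsFiltered I] {J : Type} [SmallCategory J] [FinCategory J]
    (K : J ⥤ I ⥤ C) [∀ i, HasLimit (K ⋙ (evaluation I C).obj i)] :
    PreservesLimit K (levelFunctor C I) := by
  have : PreservesLimit K (levelFunctor C I ⋙ toPresheaf C) := by
    refine preservesLimit_of_evaluation _ _ fun A => ?_
    -- Representables preserve limits, and `colim` over the filtered category `I` preserves finite
    -- ones. The universe lift moves Hom-sets to a universe where colimits over `I` exist.
    have := preservesLimit_whiskeringRight K (coyoneda.obj A ⋙ uliftFunctor.{w, v})
    exact preservesLimit_of_natIso K (levelToPresheafEvalIso A.unop)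
  exact preservesLimit_of_reflects_of_preserves (levelFunctor C I) (toPresheaf C)

/-- Finite limits that are computed and preserved by `G` pointwise are preserved by `Ind(G)`. -/
theorem preservesLimit_indFunctor {C : Type u} [Category.{v} C] {D : Type u'}
    [Category.{v'} D] {I : Type w} [SmallCategory I] [IsFiltered I] {J : Type} [SmallCategory J]
    [FinCategory J] (K : J ⥤ I ⥤ C) (G : C ⥤ D) [∀ i, HasLimit (K ⋙ (evaluation I C).obj i)]
    [∀ i, PreservesLimit (K ⋙ (evaluation I C).obj i) G] :
    PreservesLimit (K ⋙ levelFunctor C I) (indFunctor.{w} G) := by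
  have : ∀ i, HasLimit (K.flip.obj i) := fun i =>
    inferInstanceAs (HasLimit (K ⋙ (evaluation I C).obj i))
  have := preservesLimit_levelFunctor K
  have := preservesLimit_whiskeringRight K G
  have : ∀ i, HasLimit ((K ⋙ (Functor.whiskeringRight I C D).obj G) ⋙ (evaluation I D).obj i) :=
    fun i => inferInstanceAs (HasLimit ((K ⋙ (evaluation I C).obj i) ⋙ G))
  have := preservesLimit_levelFunctor (K ⋙ (Functor.whiskeringRight I C D).obj G)
  refine preservesLimit_of_preserves_limit_cone
    (isLimitOfPreserves (levelFunctor C I) (limit.isLimit K)) ?_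
  -- Applying `indFunctor G` to a levelwise cone is, by definition, whiskering the cone with `G` and
  -- then passing to ind-objects.
  exact isLimitOfPreserves ((Functor.whiskeringRight I C D).obj G ⋙ levelFunctor D I)
    (limit.isLimit K)

/-- The iterates of `Ind(T)` are induced by the iterates of `T`. -/
def iterIndFunctorIso {C : Type u} [Category.{v} C] (T : C ⥤ C) :
    ∀ m : ℕ, indFunctor.{w} (iterFunctor T m) ≅ iterFunctor (indFunctor.{w} T) m
  | 0 => indId C
  | m + 1 => indComp (iterFunctor T m) T ≪≫
      Functor.isoWhiskerRight (iterIndFunctorIso T m) (indFunctor T)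

end IndObj


/-! ## Additive bundles: functors and diagrams -/

/-- A functor that preserves the wide pullback of two copies of `q` preserves the pullback of `q`
along itself. -/
theorem isPullback_map_of_wideCospan {C : Type u} [Category.{v} C] {D : Type u'}
    [Category.{v'} D] (F : C ⥤ D) {P E M : C} {a b : P ⟶ E} {q : E ⟶ M}
    [PreservesLimit (WidePullbackShape.wideCospan M (fun _ : Fin 2 => E) (fun _ => q)) F]
    (h : IsPullback a b q q) : IsPullback (F.map a) (F.map b) (F.map q) (F.map q) := by
  -- Pullback powers are wide pullbacks over `Fin n`, whereas additive bundles carry binary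
  -- pullbacks; the square is rewritten as a wide cone with two legs.
  let s : WidePullbackCone (fun _ : Fin 2 => q) :=
    WidePullbackCone.mk (a ≫ q) (fun j => if j = 0 then a else b) (fun j => by
      split_ifs
      · rfl
      · exact h.w.symm)
  have hs : IsLimit s := WidePullbackCone.IsLimit.mk s
    (fun t => h.lift (t.π 0) (t.π 1) (by rw [t.condition, t.condition]))
    (fun t => by
      change h.lift _ _ _ ≫ a ≫ q = _
      rw [h.lift_fst_assoc, t.condition])
    (fun t j => by
      fin_cases j
      · exact h.lift_fst _ _ _
      · exact h.lift_snd _ _ _)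
    (fun t m _ hm => by
      apply h.hom_ext
      · rw [h.lift_fst]; exact hm 0
      · rw [h.lift_snd]; exact hm 1)
  have hF := isLimitOfPreserves F hs
  have fac (t : Cone (WidePullbackShape.wideCospan M (fun _ : Fin 2 => E) (fun _ => q) ⋙ F)) :
      hF.lift t ≫ F.map a = t.π.app (some 0) ∧ hF.lift t ≫ F.map b = t.π.app (some 1) :=
    ⟨hF.fac t (some 0), hF.fac t (some 1)⟩
  let cone (t : PullbackCone (F.map q) (F.map q)) :
      Cone (WidePullbackShape.wideCospan M (fun _ : Fin 2 => E) (fun _ => q) ⋙ F) :=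
    WidePullbackShape.mkCone (t.fst ≫ F.map q) (fun j => if j = 0 then t.fst else t.snd)
      (fun j => by
        fin_cases j
        · rfl
        · exact t.condition.symm)
  refine ⟨⟨by rw [← F.map_comp, ← F.map_comp, h.w]⟩,
    ⟨PullbackCone.IsLimit.mk _ (fun t => hF.lift (cone t)) (fun t => (fac _).1)
      (fun t => (fac _).2) (fun t m h₀ h₁ => ?_)⟩⟩
  refine hF.hom_ext fun j => Eq.trans ?_ (hF.fac (cone t) j).symm
  match j with
  | none =>
    change m ≫ F.map (a ≫ q) = t.fst ≫ F.map q
    rw [F.map_comp, reassoc_of% h₀]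
  | some ⟨0, _⟩ => exact h₀
  | some ⟨1, _⟩ => exact h₁

theorem HasPreservedPullbackPowers.isPullback_map {C : Type u} [Category.{v} C] {T : C ⥤ C}
    {P E M : C} {a b : P ⟶ E} {q : E ⟶ M} (hq : HasPreservedPullbackPowers T q)
    (h : IsPullback a b q q) : IsPullback (T.map a) (T.map b) (T.map q) (T.map q) := by
  have : PreservesLimit (WidePullbackShape.wideCospan M (fun _ : Fin 2 => E) (fun _ => q)) T :=
    
    have := (hq 2).2 1
    -- The first iterate is `𝟭 C ⋙ T` rather than `T` itself, hence the unitor.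
    preservesLimit_of_natIso _ (F := iterFunctor T 1) (Functor.leftUnitor T)
  exact isPullback_map_of_wideCospan T h

theorem isPullback_of_natIso {C : Type u} [Category.{v} C] {D : Type u'} [Category.{v'} D]
    {F G : C ⥤ D} (α : F ≅ G) {W X Y Z : C} {a : W ⟶ X} {b : W ⟶ Y} {f : X ⟶ Z} {g : Y ⟶ Z}
    (h : IsPullback (F.map a) (F.map b) (F.map f) (F.map g)) :
    IsPullback (G.map a) (G.map b) (G.map f) (G.map g) :=
  h.of_iso (α.app W) (α.app X) (α.app Y) (α.app Z) (by simp) (by simp) (by simp) (by simp)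

namespace AddBundle

/-- The image of an additive bundle under a functor that preserves its fibre products of two and
three factors. -/
theorem IsAdditive.map {C : Type u} [Category.{v} C] {D : Type u'} [Category.{v'} D] {E M : C}
    {B : AddBundle E M} (hB : B.IsAdditive) (L : C ⥤ D) [PreservesLimit (cospan B.q B.q) L]
    [HasWidePullback M (fun _ : Fin 3 => E) (fun _ => B.q)]
    [PreservesLimit (WidePullbackShape.wideCospan M (fun _ : Fin 3 => E) (fun _ => B.q)) L] :
    (B.map L).IsAdditive := by
  have hP : IsPullback (L.map B.π₀) (L.map B.π₁) (L.map B.q) (L.map B.q) := hB.isPullback.map L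
  have lift_eq {Z : C} (a b : Z ⟶ E) (h : a ≫ B.q = b ≫ B.q) {Y : D} (y : Y ⟶ L.obj Z)
      (a' b' : Y ⟶ L.obj E) (h') (ha : y ≫ L.map a = a') (hb : y ≫ L.map b = b') :
      hP.lift a' b' h' = y ≫ L.map (hB.isPullback.lift a b h) := by
    apply hP.hom_ext
    · rw [hP.lift_fst, Category.assoc, ← L.map_comp, IsPullback.lift_fst, ha]
    · rw [hP.lift_snd, Category.assoc, ← L.map_comp, IsPullback.lift_snd, hb]
  have lift_eq_map {Z : C} (a b : Z ⟶ E) (h : a ≫ B.q = b ≫ B.q) (a' b') (h')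
      (ha : L.map a = a') (hb : L.map b = b') :
      hP.lift a' b' h' = L.map (hB.isPullback.lift a b h) := by
    rw [lift_eq a b h (𝟙 _) a' b' h' (by rw [Category.id_comp, ha])
      (by rw [Category.id_comp, hb]), Category.id_comp]
  have map_lift_σ {Z : C} {f : Z ⟶ B.E₂} {g : Z ⟶ E} (h : f ≫ B.σ = g) {f' : L.obj Z ⟶ _}
      (hf : f' = L.map f) : f' ≫ L.map B.σ = L.map g := by
    rw [hf, ← L.map_comp, h]
  refine ⟨hP, ((CommSq.mk hB.σ_q).map L).w,
    (L.map_comp _ _).symm.trans ((congrArg L.map hB.ζ_q).trans (L.map_id _)),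
    (map_lift_σ hB.left_unit (lift_eq_map _ _ _ _ _ _ (L.map_comp _ _)
      (L.map_id _))).trans (L.map_id _),
    (map_lift_σ hB.right_unit (lift_eq_map _ _ _ _ _ _ (L.map_id _)
      (L.map_comp _ _))).trans (L.map_id _),
    map_lift_σ hB.comm (lift_eq_map _ _ _ _ _ _ rfl rfl), ?_⟩
  -- Associativity quantifies over all generalized elements in `D`, so applying `L` to the law in
  -- `C` does not suffice. As `L` preserves the triple fibre product, every triple `a, b, c` factors
  -- through the image of the universal triple `pr 0, pr 1, pr 2`, for which the law comes from `C`.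
  intro Z a b c (hab : a ≫ L.map B.q = b ≫ L.map B.q) (hbc : b ≫ L.map B.q = c ≫ L.map B.q)
  have hL := isLimitOfPreserves L
    (limit.isLimit (WidePullbackShape.wideCospan M (fun _ : Fin 3 => E) (fun _ => B.q)))
  let pr (j : Fin 3) := WidePullback.π (fun _ : Fin 3 => B.q) j
  have hpr (i j : Fin 3) : pr i ≫ B.q = pr j ≫ B.q := by
    rw [WidePullback.π_arrow (fun _ : Fin 3 => B.q),
      WidePullback.π_arrow (fun _ : Fin 3 => B.q)]
  let cone : Cone (WidePullbackShape.wideCospan M (fun _ : Fin 3 => E) (fun _ => B.q) ⋙ L) :=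
    WidePullbackShape.mkCone (a ≫ L.map B.q) (fun j : Fin 3 => ![a, b, c] j) (fun j => by
      fin_cases j
      · rfl
      · exact hab.symm
      · exact (hab.trans hbc).symm)
  let t : Z ⟶ L.obj (widePullback M (fun _ : Fin 3 => E) (fun _ => B.q)) := hL.lift cone
  have h₀ : t ≫ L.map (pr 0) = a := hL.fac cone (some 0)
  have h₁ : t ≫ L.map (pr 1) = b := hL.fac cone (some 1)
  have h₂ : t ≫ L.map (pr 2) = c := hL.fac cone (some 2)
  have e₁ := lift_eq (pr 0) (pr 1) (hpr _ _) t a b hab h₀ h₁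
  have e₂ := lift_eq (pr 1) (pr 2) (hpr _ _) t b c hbc h₁ h₂
  have e₃ := lift_eq (hB.isPullback.lift (pr 0) (pr 1) (hpr _ _) ≫ B.σ) (pr 2)
    (by simp [hB.σ_q, hpr 0 2]) t (hP.lift a b hab ≫ L.map B.σ) c
    (by rw [e₁, Category.assoc, Category.assoc, ← L.map_comp, ← L.map_comp,
          hB.σ_q, IsPullback.lift_fst_assoc, L.map_comp, reassoc_of% h₀, hab, hbc])
    (by rw [e₁, L.map_comp, Category.assoc]) h₂
  have e₄ := lift_eq (pr 0) (hB.isPullback.lift (pr 1) (pr 2) (hpr _ _) ≫ B.σ)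
    (by simp [hB.σ_q, hpr 0 1]) t a (hP.lift b c hbc ≫ L.map B.σ)
    (by rw [e₂, Category.assoc, Category.assoc, ← L.map_comp, ← L.map_comp,
          hB.σ_q, IsPullback.lift_fst_assoc, L.map_comp, reassoc_of% h₁, hab])
    h₀ (by rw [e₂, L.map_comp, Category.assoc])
  refine (congrArg (· ≫ L.map B.σ) e₃).trans (Eq.trans ?_ (congrArg (· ≫ L.map B.σ) e₄).symm)
  simp only [Category.assoc, ← L.map_comp]
  rw [hB.assoc]

/-- A bundle of diagrams that is additive pointwise is additive. -/
theorem IsAdditive.of_evaluation {C : Type u} [Category.{v} C] {I : Type w} [Category.{w'} I]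
    {E M : I ⥤ C} {B : AddBundle E M}
    (hB : ∀ i, (B.map ((evaluation I C).obj i)).IsAdditive) : B.IsAdditive := by
  have hP : IsPullback B.π₀ B.π₁ B.q B.q :=
    IsPullback.of_forall_isPullback_app fun i => (hB i).isPullback
  -- Evaluation commutes with the induced maps into the pullback, so each law reduces to the same
  -- law at `i`.
  have lift_app {Z : I ⥤ C} (a b : Z ⟶ E) (h : a ≫ B.q = b ≫ B.q) (i : I) (a' b') (h')
      (ha : a.app i = a') (hb : b.app i = b') :
      (hP.lift a b h).app i = (hB i).isPullback.lift a' b' h' := by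
    apply (hB i).isPullback.hom_ext
    · rw [IsPullback.lift_fst, ← ha]
      exact NatTrans.congr_app (hP.lift_fst a b h) i
    · rw [IsPullback.lift_snd, ← hb]
      exact NatTrans.congr_app (hP.lift_snd a b h) i
  refine ⟨hP, ?_, ?_, ?_, ?_, ?_, ?_⟩
  · ext i; exact (hB i).σ_q
  · ext i; exact (hB i).ζ_q
  · ext i
    rw [NatTrans.comp_app, lift_app _ _ _ i _ _ _ rfl rfl]
    exact (hB i).left_unit
  · ext i
    rw [NatTrans.comp_app, lift_app _ _ _ i _ _ _ rfl rfl]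
    exact (hB i).right_unit
  · ext i
    rw [NatTrans.comp_app, lift_app _ _ _ i _ _ _ rfl rfl]
    exact (hB i).comm
  · intro Z a b c hab hbc
    ext i
    have hab' : a.app i ≫ B.q.app i = b.app i ≫ B.q.app i := NatTrans.congr_app hab i
    have hbc' : b.app i ≫ B.q.app i = c.app i ≫ B.q.app i := NatTrans.congr_app hbc i
    have e₁ := lift_app a b hab i _ _ hab' rfl rfl
    have e₂ := lift_app b c hbc i _ _ hbc' rfl rfl
    have e₃ := (hB i).assoc (a.app i) (b.app i) (c.app i) hab' hbc'
    rw [NatTrans.comp_app, NatTrans.comp_app]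
    refine (congrArg (· ≫ B.σ.app i) (lift_app _ _ _ i _ _ _ ?_ rfl)).trans
      (e₃.trans (congrArg (· ≫ B.σ.app i) (lift_app _ _ _ i _ _ _ rfl ?_)).symm)
    · rw [NatTrans.comp_app, e₁]; rfl
    · rw [NatTrans.comp_app, e₂]; rfl

theorem IsMorphism.map {C : Type u} [Category.{v} C] {D : Type u'} [Category.{v'} D]
    {E M F N : C} {B : AddBundle E M} {B' : AddBundle F N} {f : E ⟶ F} {g : M ⟶ N}
    (h : IsMorphism B B' f g) (L : C ⥤ D) :
    IsMorphism (B.map L) (B'.map L) (L.map f) (L.map g) := by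
  obtain ⟨k, h₀, h₁, hσ⟩ := h.add
  exact ⟨((CommSq.mk h.w).map L).w, ⟨L.map k, ((CommSq.mk h₀).map L).w,
    ((CommSq.mk h₁).map L).w, ((CommSq.mk hσ).map L).w⟩, ((CommSq.mk h.zero).map L).w⟩

/-- A pair of maps of diagrams that is pointwise a morphism of bundles is one. -/
theorem IsMorphism.of_evaluation {C : Type u} [Category.{v} C] {I : Type w} [Category.{w'} I]
    {E M F N : I ⥤ C} {B : AddBundle E M} {B' : AddBundle F N} {f : E ⟶ F} {g : M ⟶ N}
    (hB : B.π₀ ≫ B.q = B.π₁ ≫ B.q)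
    (hB' : ∀ i, IsPullback (B'.π₀.app i) (B'.π₁.app i) (B'.q.app i) (B'.q.app i))
    (h : ∀ i, IsMorphism (B.map ((evaluation I C).obj i)) (B'.map ((evaluation I C).obj i))
      (f.app i) (g.app i)) :
    IsMorphism B B' f g := by
  have hw : f ≫ B'.q = B.q ≫ g := by ext i; exact (h i).w
  have hP : IsPullback B'.π₀ B'.π₁ B'.q B'.q := IsPullback.of_forall_isPullback_app hB'
  have hc : (B.π₀ ≫ f) ≫ B'.q = (B.π₁ ≫ f) ≫ B'.q := by
    rw [Category.assoc, Category.assoc, hw, reassoc_of% hB]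
  refine ⟨hw, ⟨hP.lift _ _ hc, hP.lift_fst _ _ _, hP.lift_snd _ _ _, ?_⟩, ?_⟩
  · ext i
    obtain ⟨k, h₀, h₁, hσ⟩ := (h i).add
    -- The pointwise maps are only known to exist, with no naturality in `i`; uniqueness identifies
    -- each with a component of the natural map given by the pullback of diagrams.
    have hk : (hP.lift _ _ hc).app i = k := by
      apply (hB' i).hom_ext
      · exact (NatTrans.congr_app (hP.lift_fst _ _ hc) i).trans h₀.symm
      · exact (NatTrans.congr_app (hP.lift_snd _ _ hc) i).trans h₁.symm
    rw [NatTrans.comp_app, hk]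
    exact hσ
  · ext i
    exact (h i).zero

end AddBundle

/-! ## Additive bundles of ind-objects -/

namespace IndObj

instance hasLimit_wideCospan_evaluation {C : Type u} [Category.{v} C] {I : Type w}
    [Category.{w'} I] {E M : I ⥤ C} (q : E ⟶ M) (n : ℕ) (i : I)
    [HasWidePullback (M.obj i) (fun _ : Fin n => E.obj i) (fun _ => q.app i)] :
    HasLimit (WidePullbackShape.wideCospan M (fun _ : Fin n => E) (fun _ => q) ⋙
      (evaluation I C).obj i) :=
  hasLimit_of_iso (F := WidePullbackShape.wideCospan (M.obj i) (fun _ : Fin n => E.obj i)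
    (fun _ => q.app i)) (WidePullbackShape.diagramIsoWideCospan
      (WidePullbackShape.wideCospan M (fun _ : Fin n => E) (fun _ => q) ⋙
        (evaluation I C).obj i)).symm

theorem hasPreservedPullbackPowers_level {C : Type u} [Category.{v} C] {I : Type w}
    [SmallCategory I] [IsFiltered I] {T : C ⥤ C} {E M : I ⥤ C} (q : E ⟶ M)
    (hq : ∀ i, HasPreservedPullbackPowers T (q.app i)) :
    HasPreservedPullbackPowers (indFunctor.{w} T) (level q) := by
  intro n
  let K := WidePullbackShape.wideCospan M (fun _ : Fin n => E) (fun _ => q)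
  have (i : I) := (hq i n).1
  have : ∀ i, HasLimit (K.flip.obj i) := fun i => hasLimit_wideCospan_evaluation q n i
  have : ∀ i, HasLimit (K ⋙ (evaluation I C).obj i) := this
  have := preservesLimit_levelFunctor K
  let e : K ⋙ levelFunctor C I ≅ WidePullbackShape.wideCospan (IndObj.of M)
    (fun _ : Fin n => IndObj.of E) (fun _ => level q) := WidePullbackShape.diagramIsoWideCospan _
  refine ⟨hasLimit_of_iso e, fun m => ?_⟩
  have (i : I) : PreservesLimit (K ⋙ (evaluation I C).obj i) (iterFunctor T m) := by
    have := (hq i n).2 m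
    exact preservesLimit_of_iso_diagram (K₁ := WidePullbackShape.wideCospan (M.obj i)
      (fun _ : Fin n => E.obj i) (fun _ => q.app i)) _ (WidePullbackShape.diagramIsoWideCospan (K ⋙ (evaluation I C).obj i)).symm
  have := preservesLimit_indFunctor K (iterFunctor T m)
  -- Preservation is known for `Ind(T^m)`, and is needed for the `m`-th iterate of `Ind(T)`.
  have := preservesLimit_of_natIso (K ⋙ levelFunctor C I) (iterIndFunctorIso T m)
  exact preservesLimit_of_iso_diagram _ e

theorem isPullback_level {C : Type u} [Category.{v} C] {I : Type w} [SmallCategory I]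
    [IsFiltered I] {P X Y Z : I ⥤ C} {a : P ⟶ X} {b : P ⟶ Y} {f : X ⟶ Z} {g : Y ⟶ Z}
    (h : ∀ i, IsPullback (a.app i) (b.app i) (f.app i) (g.app i)) :
    IsPullback (level a) (level b) (level f) (level g) := by
  have : ∀ i, HasLimit (cospan f g ⋙ (evaluation I C).obj i) := fun i =>
    have := (h i).hasPullback
    hasLimit_of_iso (F := cospan (f.app i) (g.app i))
      (cospanCompIso ((evaluation I C).obj i) f g).symm
  have := preservesLimit_levelFunctor (cospan f g)
  exact (IsPullback.of_forall_isPullback_app h).map (levelFunctor C I)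

theorem isAdditive_level {C : Type u} [Category.{v} C] {I : Type w} [SmallCategory I]
    [IsFiltered I] {T : C ⥤ C} {E M : I ⥤ C} (B : AddBundle E M)
    (hB : ∀ i, (B.map ((evaluation I C).obj i)).IsAdditive)
    (hq : ∀ i, HasPreservedPullbackPowers T (B.q.app i)) :
    (B.map (levelFunctor C I)).IsAdditive := by
  -- Triple fibre products are what transporting associativity requires.
  have (i : I) := (hq i 3).1
  have (i : I) : HasPullback (B.q.app i) (B.q.app i) := (hB i).isPullback.hasPullback
  have : ∀ i, HasLimit (cospan B.q B.q ⋙ (evaluation I C).obj i) := fun i =>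
    hasLimit_of_iso (F := cospan (B.q.app i) (B.q.app i))
      (cospanCompIso ((evaluation I C).obj i) B.q B.q).symm
  have := preservesLimit_levelFunctor (cospan B.q B.q)
  let K := WidePullbackShape.wideCospan M (fun _ : Fin 3 => E) (fun _ => B.q)
  have : ∀ i, HasLimit (K.flip.obj i) := fun i => hasLimit_wideCospan_evaluation B.q 3 i
  have : HasLimit K := inferInstance
  have : ∀ i, HasLimit (K ⋙ (evaluation I C).obj i) := ‹∀ i, HasLimit (K.flip.obj i)›
  have := preservesLimit_levelFunctor K
  exact (AddBundle.IsAdditive.of_evaluation hB).map (levelFunctor C I)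

/-- Pointwise equalizers of diagrams are equalizers of ind-objects. -/
theorem isLimit_fork_level {C : Type u} [Category.{v} C] {I : Type w} [SmallCategory I]
    [IsFiltered I] {P X Y : I ⥤ C} (e : P ⟶ X) (f g : X ⟶ Y)
    (h : ∀ i, ∃ w : e.app i ≫ f.app i = e.app i ≫ g.app i, Nonempty (IsLimit (Fork.ofι _ w))) :
    ∃ w : level e ≫ level f = level e ≫ level g, Nonempty (IsLimit (Fork.ofι _ w)) := by
  have w : e ≫ f = e ≫ g := by ext i; exact (h i).1
  have (i : I) : HasLimit (parallelPair f g ⋙ (evaluation I C).obj i) :=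
    have : HasLimit (parallelPair (f.app i) (g.app i)) := ⟨⟨_, (h i).2.some⟩⟩
    hasLimit_of_iso (parallelPair.ext (Iso.refl _) (Iso.refl _) (by simp) (by simp) :
      parallelPair (f.app i) (g.app i) ≅ parallelPair f g ⋙ (evaluation I C).obj i)
  have := preservesLimit_levelFunctor (parallelPair f g)
  have hl : IsLimit (Fork.ofι e w) := evaluationJointlyReflectsLimits _ fun i =>
    (isLimitMapConeForkEquiv ((evaluation I C).obj i) w).symm (h i).2.some
  exact ⟨_, ⟨isLimitForkMapOfIsLimit (levelFunctor C I) w hl⟩⟩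

end IndObj


/-! ## Linear morphisms preserve the additive structure -/

namespace DiffBundle

/-- Let `s = ⟨1, ζ ∘ q⟩`. The right unit law gives `μ ∘ s = λ`, so the universality pullback shows
that `λ` and `q` are jointly monic. But `λ` already determines `q`, because `p ∘ T q ∘ λ = p ∘ 0 ∘ q
= q`. -/
theorem IsDifferential.mono_lam {C : Type u} [Category.{v} C] {𝕋 : TangentData C}
    (h𝕋 : 𝕋.IsTangent) {E M : C} {B : DiffBundle 𝕋 E M} (hB : B.IsDifferential) :
    Mono B.lam := by
  obtain ⟨k, hk₀, hk₁, hpb, -⟩ := hB.universal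
  have hT := hB.powers.isPullback_map hB.additive.isPullback
  let s : E ⟶ B.E₂ := hB.additive.isPullback.lift (𝟙 E) (B.q ≫ B.ζ) (by simp [hB.additive.ζ_q])
  have hs₀ : s ≫ B.π₀ = 𝟙 E := hB.additive.isPullback.lift_fst _ _ _
  have hs₁ : s ≫ B.π₁ = B.q ≫ B.ζ := hB.additive.isPullback.lift_snd _ _ _
  have hlam : B.lam ≫ 𝕋.T.map B.q = B.q ≫ 𝕋.zero.app M := hB.lift_zero.w
  have hsk : s ≫ k = B.lam ≫ 𝕋.T.map s := by
    apply hT.hom_ext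
    · rw [Category.assoc, hk₀, reassoc_of% hs₀, Category.assoc, ← 𝕋.T.map_comp, hs₀,
        𝕋.T.map_id, Category.comp_id]
    · rw [Category.assoc, hk₁, reassoc_of% hs₁, Category.assoc, ← 𝕋.T.map_comp, hs₁,
        𝕋.T.map_comp, reassoc_of% hlam]
      exact congrArg (B.q ≫ ·) (𝕋.zero.naturality B.ζ)
  have hsμ : s ≫ k ≫ 𝕋.T.map B.σ = B.lam := by
    rw [reassoc_of% hsk, ← 𝕋.T.map_comp,
      show s ≫ B.σ = 𝟙 E from hB.additive.right_unit, 𝕋.T.map_id, Category.comp_id]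
  have hsq : (s ≫ B.π₁ ≫ B.q) = B.q := by
    rw [reassoc_of% hs₁, hB.additive.ζ_q, Category.comp_id]
  have hzero : 𝕋.zero.app M ≫ 𝕋.p.app M = 𝟙 M := (h𝕋.additive M).ζ_q
  refine ⟨fun {Z} a b hab => ?_⟩
  have hq : a ≫ B.q = b ≫ B.q := by
    have h := congrArg (fun t => t ≫ 𝕋.T.map B.q ≫ 𝕋.p.app M) hab
    simpa only [Category.assoc, reassoc_of% hlam, hzero, Category.comp_id] using h
  have h : a ≫ s = b ≫ s := by
    apply hpb.hom_ext
    · rw [Category.assoc, Category.assoc, hsμ, hab]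
    · rw [Category.assoc, Category.assoc, hsq, hq]
  simpa only [Category.assoc, hs₀, Category.comp_id] using congrArg (fun t => t ≫ B.π₀) h

namespace IsLinearMorphism

/-- After precomposition with `q`, both sides become `p ∘ λ' ∘ f`, by linearity and naturality of
`p`; and `q` can be cancelled because `ζ` is a section of it. -/
theorem zero {C : Type u} [Category.{v} C] {𝕋 : TangentData C} {E M F N : C}
    {B : DiffBundle 𝕋 E M} {B' : DiffBundle 𝕋 F N} {f : E ⟶ F} {g : M ⟶ N}
    (h : IsLinearMorphism B B' f g) (hB : B.IsDifferential) (hB' : B'.IsDifferential) :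
    g ≫ B'.ζ = B.ζ ≫ f := by
  have e₁ : B.lam ≫ 𝕋.p.app E = B.q ≫ B.ζ := hB.lift_zeta.w
  have e₂ : B'.lam ≫ 𝕋.p.app F = B'.q ≫ B'.ζ := hB'.lift_zeta.w
  have e₃ : 𝕋.T.map f ≫ 𝕋.p.app F = 𝕋.p.app E ≫ f := 𝕋.p.naturality f
  have e : B.q ≫ g ≫ B'.ζ = B.q ≫ B.ζ ≫ f := by
    rw [← reassoc_of% h.w, ← e₂, reassoc_of% h.lift, e₃, reassoc_of% e₁]
  simpa only [← Category.assoc, hB.additive.ζ_q, Category.id_comp] using congrArg (B.ζ ≫ ·) e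

/-- Since `λ'` is monic, it suffices to compare after `λ'`. There `σ` and `σ'` turn into the
additions of the tangent bundles of `E` and `F`, which `T f` respects by naturality of `+`. -/
theorem add {C : Type u} [Category.{v} C] {𝕋 : TangentData C} (h𝕋 : 𝕋.IsTangent)
    {E M F N : C} {B : DiffBundle 𝕋 E M} {B' : DiffBundle 𝕋 F N} {f : E ⟶ F} {g : M ⟶ N}
    (h : IsLinearMorphism B B' f g) (hB : B.IsDifferential) (hB' : B'.IsDifferential)
    {k : B.E₂ ⟶ B'.E₂} (hk₀ : k ≫ B'.π₀ = B.π₀ ≫ f) (hk₁ : k ≫ B'.π₁ = B.π₁ ≫ f) :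
    k ≫ B'.σ = B.σ ≫ f := by
  have := hB'.mono_lam h𝕋
  obtain ⟨l, hl₀, hl₁, hl⟩ := hB.lift_zeta.add
  obtain ⟨l', hl'₀, hl'₁, hl'⟩ := hB'.lift_zeta.add
  dsimp only [TangentData.tangentBundle] at l hl₀ hl₁ hl l' hl'₀ hl'₁ hl'
  have e : l ≫ 𝕋.T₂.map f = k ≫ l' := by
    apply (h𝕋.additive F).isPullback.hom_ext
    · change (l ≫ 𝕋.T₂.map f) ≫ 𝕋.π₀.app F = (k ≫ l') ≫ 𝕋.π₀.app F
      rw [Category.assoc, Category.assoc, hl'₀, reassoc_of% hk₀, h.lift, 𝕋.π₀.naturality,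
        reassoc_of% hl₀]
    · change (l ≫ 𝕋.T₂.map f) ≫ 𝕋.π₁.app F = (k ≫ l') ≫ 𝕋.π₁.app F
      rw [Category.assoc, Category.assoc, hl'₁, reassoc_of% hk₁, h.lift, 𝕋.π₁.naturality,
        reassoc_of% hl₁]
  rw [← cancel_mono B'.lam, Category.assoc, Category.assoc, ← hl', h.lift, ← reassoc_of% hl,
    ← 𝕋.add.naturality, reassoc_of% e]

end IsLinearMorphism

end DiffBundle

/-! ## The tangent structure on ind-objects -/

/-- The fork depends on the proof of its condition, so the parallel maps are replaced by equal ones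
through substitution instead of rewriting. -/
theorem exists_isLimit_fork_congr {C : Type u} [Category.{v} C] {P X Y : C} {e : P ⟶ X}
    {f f' g g' : X ⟶ Y} (hf : f = f') (hg : g = g')
    (h : ∃ w : e ≫ f' = e ≫ g', Nonempty (IsLimit (Fork.ofι e w))) :
    ∃ w : e ≫ f = e ≫ g, Nonempty (IsLimit (Fork.ofι e w)) := by
  subst hf hg
  exact h

namespace TangentData

/-- The maps `p` at the objects of a diagram. -/
@[simps app]
def pDiagram {C : Type u} [Category.{v} C] (𝕋 : TangentData C) {I : Type w} [Category.{w'} I]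
    (F : I ⥤ C) : F ⋙ 𝕋.T ⟶ F where
  app i := 𝕋.p.app (F.obj i)
  naturality _ _ φ := 𝕋.p.naturality (F.map φ)

/-- The maps `0` at the objects of a diagram. -/
@[simps app]
def zeroDiagram {C : Type u} [Category.{v} C] (𝕋 : TangentData C) {I : Type w} [Category.{w'} I]
    (F : I ⥤ C) : F ⟶ F ⋙ 𝕋.T where
  app i := 𝕋.zero.app (F.obj i)
  naturality _ _ φ := 𝕋.zero.naturality (F.map φ)

/-- The maps `ℓ` at the objects of a diagram. -/
@[simps app]
def liftDiagram {C : Type u} [Category.{v} C] (𝕋 : TangentData C) {I : Type w} [Category.{w'} I]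
    (F : I ⥤ C) : F ⋙ 𝕋.T ⟶ (F ⋙ 𝕋.T) ⋙ 𝕋.T where
  app i := 𝕋.ℓ.app (F.obj i)
  naturality _ _ φ := 𝕋.ℓ.naturality (F.map φ)

/-- The maps `c` at the objects of a diagram. -/
@[simps app]
def flipDiagram {C : Type u} [Category.{v} C] (𝕋 : TangentData C) {I : Type w} [Category.{w'} I]
    (F : I ⥤ C) : (F ⋙ 𝕋.T) ⋙ 𝕋.T ⟶ (F ⋙ 𝕋.T) ⋙ 𝕋.T where
  app i := 𝕋.c.app (F.obj i)
  naturality _ _ φ := 𝕋.c.naturality (F.map φ)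

/-- The tangent bundles of the objects of a diagram. -/
def diagramTangentBundle {C : Type u} [Category.{v} C] (𝕋 : TangentData C) {I : Type w}
    [Category.{w'} I] (F : I ⥤ C) : AddBundle (F ⋙ 𝕋.T) F where
  q := 𝕋.pDiagram F
  E₂ := F ⋙ 𝕋.T₂
  π₀ := Functor.whiskerLeft F 𝕋.π₀
  π₁ := Functor.whiskerLeft F 𝕋.π₁
  σ := Functor.whiskerLeft F 𝕋.add
  ζ := 𝕋.zeroDiagram F

section

variable {C : Type u} [Category.{v} C] (𝕋 : TangentData C) {I : Type w} [SmallCategory I]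
  [IsFiltered I] (F : I ⥤ C)

/-- The coherence isomorphisms `indId` and `indComp` have identity components, so here and in the
next lemmas the structure maps at a levelwise object differ from levelwise ones only by composition
with identities. -/
theorem ind_p_app : 𝕋.ind.p.app (IndObj.of F) = IndObj.level (𝕋.pDiagram F) :=
  Category.comp_id (IndObj.level (𝕋.pDiagram F))

theorem ind_zero_app : 𝕋.ind.zero.app (IndObj.of F) = IndObj.level (𝕋.zeroDiagram F) :=
  Category.id_comp (IndObj.level (𝕋.zeroDiagram F))

theorem ind_ℓ_app : 𝕋.ind.ℓ.app (IndObj.of F) = IndObj.level (𝕋.liftDiagram F) :=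
  Category.comp_id (IndObj.level (𝕋.liftDiagram F))

theorem ind_c_app : 𝕋.ind.c.app (IndObj.of F) = IndObj.level (𝕋.flipDiagram F) :=
  (Category.id_comp (IndObj.level (𝕋.flipDiagram F) ≫ 𝟙 _)).trans (Category.comp_id _)

theorem ind_tangentBundle : 𝕋.ind.tangentBundle (IndObj.of F) =
    (𝕋.diagramTangentBundle F).map (IndObj.levelFunctor C I) := by
  unfold tangentBundle
  rw [ind_p_app, ind_zero_app]
  rfl

end

/-- The tangent structure on ind-objects is a tangent structure. -/
theorem IsTangent.ind {C : Type u} [Category.{v} C] {𝕋 : TangentData C} (h𝕋 : 𝕋.IsTangent) :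
    (𝕋.ind : TangentData (IndObj.{w} C)).IsTangent := by
  have hpb (X : C) : IsPullback (𝕋.π₀.app X) (𝕋.π₁.app X) (𝕋.p.app X) (𝕋.p.app X) :=
    (h𝕋.additive X).isPullback
  have hTpb (X : C) := (h𝕋.powers X).isPullback_map (hpb X)
  refine
    { powers := fun X => ?_
      additive := fun X => ?_
      lift_morphism := fun X => ?_
      flip_morphism := fun X => ?_
      flip_flip := fun X => ?_
      lift_flip := fun X => ?_
      lift_lift := fun X => ?_
      yang_baxter := fun X => ?_
      flip_lift := fun X => ?_
      universal := fun X => ?_ } <;> obtain ⟨I, F⟩ := X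
  · rw [ind_p_app]
    exact IndObj.hasPreservedPullbackPowers_level _ fun i => h𝕋.powers _
  · rw [ind_tangentBundle]
    exact IndObj.isAdditive_level (T := 𝕋.T) _ (fun i => h𝕋.additive (F.obj i))
      (fun i => h𝕋.powers (F.obj i))
  · rw [ind_tangentBundle, ind_ℓ_app, ind_zero_app]
    -- The target bundle is also levelwise: `Ind(T)` of a levelwise map is by definition the
    -- levelwise map of its whiskering with `T`.
    exact AddBundle.IsMorphism.map (B := 𝕋.diagramTangentBundle F)
      (B' := (𝕋.diagramTangentBundle F).map ((Functor.whiskeringRight I C C).obj 𝕋.T))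
      (f := 𝕋.liftDiagram F) (g := 𝕋.zeroDiagram F)
      (.of_evaluation (by ext i; exact (hpb (F.obj i)).w) (fun i => hTpb (F.obj i))
        (fun i => h𝕋.lift_morphism (F.obj i))) (IndObj.levelFunctor C I)
  · change AddBundle.IsMorphism _ (𝕋.ind.tangentBundle (IndObj.of (F ⋙ 𝕋.T))) _
      (IndObj.level (𝟙 (F ⋙ 𝕋.T)))
    rw [ind_tangentBundle, ind_tangentBundle, ind_c_app]
    exact AddBundle.IsMorphism.map
      (B := (𝕋.diagramTangentBundle F).map ((Functor.whiskeringRight I C C).obj 𝕋.T))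
      (B' := 𝕋.diagramTangentBundle (F ⋙ 𝕋.T)) (f := 𝕋.flipDiagram F) (g := 𝟙 _)
      (.of_evaluation (by ext i; exact (hTpb (F.obj i)).w) (fun i => hpb (𝕋.T.obj (F.obj i)))
        (fun i => h𝕋.flip_morphism (F.obj i))) (IndObj.levelFunctor C I)
  · rw [ind_c_app]
    exact congrArg IndObj.level (a₂ := 𝟙 _) (NatTrans.ext (funext fun i =>
      h𝕋.flip_flip (F.obj i)) : 𝕋.flipDiagram F ≫ 𝕋.flipDiagram F = 𝟙 _)
  · rw [ind_c_app, ind_ℓ_app]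
    exact congrArg IndObj.level (NatTrans.ext (funext fun i =>
      h𝕋.lift_flip (F.obj i)) : 𝕋.liftDiagram F ≫ 𝕋.flipDiagram F = 𝕋.liftDiagram F)
  · change _ ≫ 𝕋.ind.T.map (𝕋.ind.ℓ.app (IndObj.of F)) =
      _ ≫ 𝕋.ind.ℓ.app (IndObj.of (F ⋙ 𝕋.T))
    rw [ind_ℓ_app, ind_ℓ_app]
    exact congrArg IndObj.level (NatTrans.ext (funext fun i => h𝕋.lift_lift (F.obj i)) :
      𝕋.liftDiagram F ≫ Functor.whiskerRight (𝕋.liftDiagram F) 𝕋.T =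
        𝕋.liftDiagram F ≫ 𝕋.liftDiagram (F ⋙ 𝕋.T))
  · change _ ≫ 𝕋.ind.c.app (IndObj.of (F ⋙ 𝕋.T)) ≫ _ =
      𝕋.ind.c.app (IndObj.of (F ⋙ 𝕋.T)) ≫ _ ≫ 𝕋.ind.c.app (IndObj.of (F ⋙ 𝕋.T))
    rw [ind_c_app, ind_c_app]
    exact congrArg IndObj.level (NatTrans.ext (funext fun i => h𝕋.yang_baxter (F.obj i)) :
      Functor.whiskerRight (𝕋.flipDiagram F) 𝕋.T ≫ 𝕋.flipDiagram (F ⋙ 𝕋.T) ≫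
        Functor.whiskerRight (𝕋.flipDiagram F) 𝕋.T =
      𝕋.flipDiagram (F ⋙ 𝕋.T) ≫ Functor.whiskerRight (𝕋.flipDiagram F) 𝕋.T ≫
        𝕋.flipDiagram (F ⋙ 𝕋.T))
  · change 𝕋.ind.ℓ.app (IndObj.of (F ⋙ 𝕋.T)) ≫ _ ≫ 𝕋.ind.c.app (IndObj.of (F ⋙ 𝕋.T)) =
      _ ≫ 𝕋.ind.T.map (𝕋.ind.ℓ.app (IndObj.of F))
    rw [ind_c_app, ind_c_app, ind_ℓ_app, ind_ℓ_app]
    exact congrArg IndObj.level (NatTrans.ext (funext fun i => h𝕋.flip_lift (F.obj i)) :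
      𝕋.liftDiagram (F ⋙ 𝕋.T) ≫ Functor.whiskerRight (𝕋.flipDiagram F) 𝕋.T ≫
        𝕋.flipDiagram (F ⋙ 𝕋.T) =
      𝕋.flipDiagram F ≫ Functor.whiskerRight (𝕋.liftDiagram F) 𝕋.T)
  -- The map `k` of the universality axiom is given separately for each object, so it is rebuilt as
  -- a natural transformation from the pullback of diagrams and then matched pointwise with the
  -- given ones.
  · let a := Functor.whiskerRight (Functor.whiskerLeft F 𝕋.π₀) 𝕋.T
    let b := Functor.whiskerRight (Functor.whiskerLeft F 𝕋.π₁) 𝕋.T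
    have hP : IsPullback a b (Functor.whiskerRight (𝕋.pDiagram F) 𝕋.T)
        (Functor.whiskerRight (𝕋.pDiagram F) 𝕋.T) :=
      .of_forall_isPullback_app fun i => hTpb (F.obj i)
    have hw : (Functor.whiskerLeft F 𝕋.π₀ ≫ 𝕋.liftDiagram F) ≫
          Functor.whiskerRight (𝕋.pDiagram F) 𝕋.T =
        (Functor.whiskerLeft F 𝕋.π₁ ≫ 𝕋.zeroDiagram (F ⋙ 𝕋.T)) ≫
          Functor.whiskerRight (𝕋.pDiagram F) 𝕋.T := by
      ext i
      obtain ⟨k, h₀, h₁, -⟩ := h𝕋.universal (F.obj i)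
      change (𝕋.π₀.app _ ≫ 𝕋.ℓ.app _) ≫ 𝕋.T.map (𝕋.p.app _) =
        (𝕋.π₁.app _ ≫ 𝕋.zero.app _) ≫ 𝕋.T.map (𝕋.p.app _)
      -- The pointwise `k` already witnesses this compatibility: both sides factor through it,
      -- followed by the two legs of the pullback square of `T p`.
      rw [← h₀, ← h₁, Category.assoc, Category.assoc, (hTpb _).w]
    let k : F ⋙ 𝕋.T₂ ⟶ (F ⋙ 𝕋.T₂) ⋙ 𝕋.T := hP.lift _ _ hw
    have hk₀ : k ≫ a = Functor.whiskerLeft F 𝕋.π₀ ≫ 𝕋.liftDiagram F := hP.lift_fst _ _ _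
    have hk₁ : k ≫ b = Functor.whiskerLeft F 𝕋.π₁ ≫ 𝕋.zeroDiagram (F ⋙ 𝕋.T) :=
      hP.lift_snd _ _ _
    refine ⟨IndObj.level k, ?_, ?_, ?_⟩
    · rw [ind_ℓ_app]
      exact congrArg IndObj.level hk₀
    · change _ = _ ≫ 𝕋.ind.zero.app (IndObj.of (F ⋙ 𝕋.T))
      rw [ind_zero_app]
      exact congrArg IndObj.level hk₁
    · have hg : 𝕋.ind.p.app (IndObj.of (F ⋙ 𝕋.T)) ≫ 𝕋.ind.p.app (IndObj.of F) ≫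
          𝕋.ind.zero.app (IndObj.of F) =
          IndObj.level (𝕋.pDiagram (F ⋙ 𝕋.T) ≫ 𝕋.pDiagram F ≫ 𝕋.zeroDiagram F) := by
        rw [ind_p_app, ind_p_app, ind_zero_app]
        rfl
      refine exists_isLimit_fork_congr (congrArg 𝕋.ind.T.map (𝕋.ind_p_app F)) hg
        (IndObj.isLimit_fork_level
          (k ≫ Functor.whiskerRight (Functor.whiskerLeft F 𝕋.add) 𝕋.T)
          (Functor.whiskerRight (𝕋.pDiagram F) 𝕋.T)
          (𝕋.pDiagram (F ⋙ 𝕋.T) ≫ 𝕋.pDiagram F ≫ 𝕋.zeroDiagram F) fun i => ?_)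
      obtain ⟨k', h₀, h₁, h⟩ := h𝕋.universal (F.obj i)
      have hk : k.app i = k' := by
        apply (hTpb (F.obj i)).hom_ext
        · exact (NatTrans.congr_app hk₀ i).trans h₀.symm
        · exact (NatTrans.congr_app hk₁ i).trans h₁.symm
      subst hk
      exact h

end TangentData

/-! ## Differential bundles of ind-objects -/

namespace DiffBundleDiagram

section

variable {C : Type u} [Category.{v} C] {𝕋 : TangentData C} {I : Type w} [Category.{w'} I]
  {E M : I ⥤ C} (B : DiffBundleDiagram 𝕋 E M)

/-- The additive bundle of diagrams underlying a diagram of differential bundles. -/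
noncomputable def toAddBundle (h𝕋 : 𝕋.IsTangent) : AddBundle E M where
  q :=
    { app := fun i => (B.bundle i).q
      naturality := fun _ _ φ => (B.isLinear φ).w }
  E₂ := B.E₂
  π₀ := B.π₀
  π₁ := B.π₁
  σ :=
    { app := fun i => (B.bundle i).σ
      -- The induced transition map on fibre products plays the role of `k` in
      -- `IsLinearMorphism.add`.
      naturality := fun i i' φ => (B.isLinear φ).add h𝕋 (B.isDifferential i)
        (B.isDifferential i') (B.π₀.naturality φ) (B.π₁.naturality φ) }
  ζ :=
    { app := fun i => (B.bundle i).ζ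
      naturality := fun i i' φ => (B.isLinear φ).zero (B.isDifferential i) (B.isDifferential i') }

/-- The lifts `λ_i` of a diagram of differential bundles. -/
def lam : E ⟶ E ⋙ 𝕋.T where
  app i := (B.bundle i).lam
  naturality _ _ φ := (B.isLinear φ).lift

end

/-- The levelwise bundle of ind-objects of a diagram of differential bundles is a differential
bundle. -/
theorem isDifferential_levelBundle {C : Type u} [Category.{v} C] {𝕋 : TangentData C}
    (h𝕋 : 𝕋.IsTangent) {I : Type w} [SmallCategory I] [IsFiltered I] {E M : I ⥤ C}
    (B : DiffBundleDiagram 𝕋 E M) :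
    (𝕋.levelBundle (B.toAddBundle h𝕋).q B.π₀ B.π₁ (B.toAddBundle h𝕋).σ (B.toAddBundle h𝕋).ζ
      B.lam).IsDifferential := by
  let D := B.toAddBundle h𝕋
  have hpb (i : I) := (B.isDifferential i).additive.isPullback
  have hTpb (i : I) := (B.isDifferential i).powers.isPullback_map (hpb i)
  have hD : D.π₀ ≫ D.q = D.π₁ ≫ D.q := by ext i; exact (hpb i).w
  refine
    { additive := ?_
      powers := ?_
      lift_zero := ?_
      lift_zeta := ?_
      universal := ?_
      lift_lift := ?_ }
  · exact IndObj.isAdditive_level (T := 𝕋.T) D (fun i => (B.isDifferential i).additive)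
      (fun i => (B.isDifferential i).powers)
  · exact IndObj.hasPreservedPullbackPowers_level D.q (fun i => (B.isDifferential i).powers)
  · rw [TangentData.ind_zero_app]
    exact AddBundle.IsMorphism.map (B := D)
      (B' := D.map ((Functor.whiskeringRight I C C).obj 𝕋.T)) (f := B.lam)
      (g := 𝕋.zeroDiagram M)
      (.of_evaluation hD hTpb (fun i => (B.isDifferential i).lift_zero))
      (IndObj.levelFunctor C I)
  · rw [TangentData.ind_tangentBundle]
    exact AddBundle.IsMorphism.map (B := D) (B' := 𝕋.diagramTangentBundle E)
      (f := B.lam) (g := D.ζ)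
      (.of_evaluation hD (fun i => (h𝕋.additive (E.obj i)).isPullback)
        (fun i => (B.isDifferential i).lift_zeta)) (IndObj.levelFunctor C I)
  · let a := Functor.whiskerRight D.π₀ 𝕋.T
    let b := Functor.whiskerRight D.π₁ 𝕋.T
    have hP : IsPullback a b (Functor.whiskerRight D.q 𝕋.T) (Functor.whiskerRight D.q 𝕋.T) :=
      .of_forall_isPullback_app hTpb
    have hw : (D.π₀ ≫ B.lam) ≫ Functor.whiskerRight D.q 𝕋.T =
        (D.π₁ ≫ 𝕋.zeroDiagram E) ≫ Functor.whiskerRight D.q 𝕋.T := by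
      ext i
      obtain ⟨k, h₀, h₁, -⟩ := (B.isDifferential i).universal
      change ((B.bundle i).π₀ ≫ (B.bundle i).lam) ≫ 𝕋.T.map (B.bundle i).q =
        ((B.bundle i).π₁ ≫ 𝕋.zero.app _) ≫ 𝕋.T.map (B.bundle i).q
      rw [← h₀, ← h₁, Category.assoc, Category.assoc, (hTpb i).w]
    let k : D.E₂ ⟶ D.E₂ ⋙ 𝕋.T := hP.lift _ _ hw
    have hk₀ : k ≫ a = D.π₀ ≫ B.lam := hP.lift_fst _ _ _
    have hk₁ : k ≫ b = D.π₁ ≫ 𝕋.zeroDiagram E := hP.lift_snd _ _ _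
    -- Uniqueness into the pullback preserved by `T` makes any pointwise choice of `⟨λ ∘ π₀, 0 ∘
    -- π₁⟩` agree with the natural one.
    have hk (i : I) (k' : (B.bundle i).E₂ ⟶ 𝕋.T.obj (B.bundle i).E₂)
        (h₀ : k' ≫ 𝕋.T.map (B.bundle i).π₀ = (B.bundle i).π₀ ≫ (B.bundle i).lam)
        (h₁ : k' ≫ 𝕋.T.map (B.bundle i).π₁ = (B.bundle i).π₁ ≫ 𝕋.zero.app (E.obj i)) :
        k' = k.app i := by
      apply (hTpb i).hom_ext
      · exact h₀.trans (NatTrans.congr_app hk₀ i).symm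
      · exact h₁.trans (NatTrans.congr_app hk₁ i).symm
    let μ : D.E₂ ⟶ E ⋙ 𝕋.T := k ≫ Functor.whiskerRight D.σ 𝕋.T
    refine ⟨IndObj.level k, congrArg IndObj.level hk₀, ?_, ?_, fun n => ?_⟩
    · rw [TangentData.ind_zero_app]
      exact congrArg IndObj.level hk₁
    · rw [TangentData.ind_zero_app]
      refine IndObj.isPullback_level (a := μ) (b := D.π₁ ≫ D.q)
        (f := Functor.whiskerRight D.q 𝕋.T) (g := 𝕋.zeroDiagram M) fun i => ?_
      obtain ⟨k', h₀, h₁, h, -⟩ := (B.isDifferential i).universal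
      rw [hk i k' h₀ h₁] at h
      exact h
    -- Up to the isomorphism between `Ind(T^n)` and the `n`-th iterate of `Ind(T)`, this is the
    -- levelwise square of the `T^n`-images of the given squares, each a pullback by hypothesis.
    · rw [TangentData.ind_zero_app]
      refine isPullback_of_natIso (IndObj.iterIndFunctorIso 𝕋.T n)
        (a := IndObj.level μ) (b := IndObj.level (D.π₁ ≫ D.q))
        (f := IndObj.level (Functor.whiskerRight D.q 𝕋.T))
        (g := IndObj.level (𝕋.zeroDiagram M)) ?_
      let R := (Functor.whiskeringRight I C C).obj (iterFunctor 𝕋.T n)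
      refine IndObj.isPullback_level (a := R.map μ) (b := R.map (D.π₁ ≫ D.q))
        (f := R.map (Functor.whiskerRight D.q 𝕋.T)) (g := R.map (𝕋.zeroDiagram M)) fun i => ?_
      obtain ⟨k', h₀, h₁, -, h⟩ := (B.isDifferential i).universal
      rw [hk i k' h₀ h₁] at h
      exact h n
  · rw [TangentData.ind_ℓ_app]
    exact congrArg IndObj.level (NatTrans.ext (funext fun i => (B.isDifferential i).lift_lift) :
      B.lam ≫ 𝕋.liftDiagram E = B.lam ≫ Functor.whiskerRight B.lam 𝕋.T)

end DiffBundleDiagram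

theorem mainTheorem7 {C : Type u} [Category.{v} C] (𝕋 : TangentData C) (h𝕋 : 𝕋.IsTangent)
    {I : Type w} [SmallCategory I] [IsFiltered I] (E M : I ⥤ C)
    (B : ∀ i : I, DiffBundle 𝕋 (E.obj i) (M.obj i))
    (hB : ∀ i : I, (B i).IsDifferential)
    (hlin : ∀ {i i' : I} (φ : i ⟶ i'),
      DiffBundle.IsLinearMorphism (B i) (B i') (E.map φ) (M.map φ)) :
    (𝕋.ind : TangentData (IndObj.{w} C)).IsTangent ∧
    ∃ (q : E ⟶ M) (σ : (DiffBundleDiagram.mk B hB hlin).E₂ ⟶ E) (ζ : M ⟶ E)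
      (lam : E ⟶ E ⋙ 𝕋.T),
      (∀ i : I, q.app i = (B i).q) ∧
      (∀ i : I, σ.app i = (B i).σ) ∧
      (∀ i : I, ζ.app i = (B i).ζ) ∧
      (∀ i : I, lam.app i = (B i).lam) ∧
      (𝕋.levelBundle q (DiffBundleDiagram.mk B hB hlin).π₀ (DiffBundleDiagram.mk B hB hlin).π₁
        σ ζ lam).IsDifferential := by
  let D : DiffBundleDiagram 𝕋 E M := DiffBundleDiagram.mk B hB hlin
  exact ⟨h𝕋.ind, (D.toAddBundle h𝕋).q, (D.toAddBundle h𝕋).σ, (D.toAddBundle h𝕋).ζ, D.lam,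
    fun _ => rfl, fun _ => rfl, fun _ => rfl, fun _ => rfl, D.isDifferential_levelBundle h𝕋⟩
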